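/- Let $F$ be a field of characteristic $p$, where characteristic $0$ is written $p=\infty$. Let $S_n$ be the symmetric group, with permutations composed from left to right. For a composition $q=(q_1,\dots,q_k)$ of $n$ let $S_q=S_{q_1}\times\cdots\times S_{q_k}\le S_n$ be the Young subgroup, and let $\Xi^q\in F S_n$ be the sum of the minimal length representatives of the right cosets of $S_q$ in $S_n$. The elements $\Xi^q$, for $q$ running over the compositions of $n$, are a basis of a subalgebra $\mathscr D_n(F)$ of $FS_n$, the descent algebra. For $s\ge 1$ let $\Delta_s:\mathscr D_{n+s}(F)\to\mathscr D_n(F)$ be the algebra homomorphism with $\Delta_s(\Xi^q)=\sum_{i:\,q_i\ge s}\Xi^{q^{(i)}}$, where $q^{(i)}$ is obtained from $q$ by replacing $q_i$ by $q_i-s$ and deleting this entry if it is $0$. For a partition $\mu$ of $n$ let $\varphi^q(\mu)$ be the number of right cosets of $S_q$ in $S_n$ that are fixed by (right multiplication with) a permutation of cycle type $\mu$, and let $M_{\mu,F}$ be the one-dimensional $\mathscr D_n(F)$-module on which $\Xi^q$ acts as the scalar $\varphi^q(\mu)\cdot 1_F$. A partition is $p$-regular if each part occurs at most $p-1$ times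 (no condition if $p=\infty$). Partitions $\lambda,\mu$ of $n$ are $p$-equivalent if the $p'$-parts of permutations of cycle types $\lambda$ and $\mu$ are conjugate in $S_n$ (for $p=\infty$: if $\lambda=\mu$). **Theorem.** Let $s\ge 1$. For every $n\ge 0$ and every $p$-regular partition $\mu$ of $n$ there is exactly one $p$-regular partition $\mu^{\#s}$ of $n+s$ that is $p$-equivalent to the partition obtained from $\mu$ by appending a part $s$. The modules $M_{\mu,F}$ and $M_{\mu^{\#s},F}$ are simple, and the pullback of $M_{\mu,F}$ along $\Delta_s$ is isomorphic to $M_{\mu^{\#s},F}$ as a $\mathscr D_{n+s}(F)$-module. Moreover, the map $\mu\mapsto\mu^{\#s}$ on the set of all $p$-regular partitions (of all $n\ge 0$) is injective. -/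

import Mathlib

/-!
Descent algebras of symmetric groups over a commutative ring, the Young characters, the
simple modules, and the Bergeron-Garsia-Reutenauer map.  Permutations of `n` letters are
`Equiv.Perm (Fin n)`; they are multiplied from left to right, that is, in the opposite group
`(Equiv.Perm (Fin n))ᵐᵒᵖ` of Mathlib's group of permutations.
-/

namespace Descent

open Finset MulOpposite

/-! ### The elements `Ξ^q` -/

/-- The length of a permutation: its number of inversions. -/
def length {n : ℕ} (w : Equiv.Perm (Fin n)) : ℕ :=
  #{x : Fin n × Fin n | x.1 < x.2 ∧ w x.2 < w x.1}

/-- The Young subgroup of a composition `q`: the permutations that preserve every block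
`[q₁ + ⋯ + qᵢ₋₁ + 1, q₁ + ⋯ + qᵢ]`.  (`q.index x` is the number of the block of `x`.) -/
def youngSubgroup {n : ℕ} (q : Composition n) : Subgroup (Equiv.Perm (Fin n)) where
  carrier := {h | ∀ x, q.index (h x) = q.index x}
  one_mem' := fun _ => rfl
  mul_mem' := fun {a b} ha hb x => (ha (b x)).trans (hb x)
  inv_mem' := fun {a} ha x => by
    have h : q.index (a (a⁻¹ x)) = q.index (a⁻¹ x) := ha (a⁻¹ x)
    have e : a (a⁻¹ x) = x := Equiv.apply_symm_apply a x
    rw [e] at h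
    exact h.symm

/-- `w` has minimal length in its coset of the Young subgroup of `q`.  With products read from
left to right this is the right coset of `w`, in Mathlib's notation `w * youngSubgroup q`. -/
def IsMinimal {n : ℕ} (q : Composition n) (w : Equiv.Perm (Fin n)) : Prop :=
  ∀ h ∈ youngSubgroup q, length w ≤ length (w * h)

open Classical in
/-- `Ξ^q`: the sum, in the group algebra, of the minimal length representatives of the right
cosets of the Young subgroup of `q`. -/
noncomputable def Xi (R : Type*) [CommRing R] {n : ℕ} (q : Composition n) :
    MonoidAlgebra R (Equiv.Perm (Fin n))ᵐᵒᵖ :=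
  ∑ w : Equiv.Perm (Fin n) with IsMinimal q w, MonoidAlgebra.of R _ (op w)

/-! ### Minimal representatives and words -/

theorem index_mono {n : ℕ} (q : Composition n) : Monotone q.index := by
  intro x y hxy
  by_contra hlt
  rw [not_le] at hlt
  have h1 := q.lt_sizeUpTo_index_succ y
  have h2 := q.sizeUpTo_index_le x
  have h3 : q.sizeUpTo (q.index y).succ ≤ q.sizeUpTo (q.index x) := by
    apply q.monotone_sizeUpTo
    simpa [Nat.succ_le_iff] using hlt
  have h4 : (x : ℕ) ≤ y := hxy
  simp only [Fin.val_succ] at h1 h3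
  omega

/-- The number of occurrences of each letter in a word. -/
def content {n : ℕ} {L : Type*} [DecidableEq L] (f : Fin n → L) (l : L) : ℕ :=
  #{x | f x = l}

theorem content_index {n : ℕ} (q : Composition n) : content q.index = q.blocksFun := by
  funext i
  unfold content
  have : (univ.filter fun x => q.index x = i) = univ.map (q.embedding i).toEmbedding := by
    ext x
    simp only [mem_filter, mem_univ, true_and, mem_map]
    constructor
    · rintro rfl
      exact ⟨q.invEmbedding x, q.embedding_comp_inv x⟩
    · rintro ⟨j, rfl⟩
      exact q.index_embedding i j
  rw [this, card_map, card_univ, Fintype.card_fin]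

theorem content_comp_perm {n : ℕ} {L : Type*} [DecidableEq L] (f : Fin n → L)
    (w : Equiv.Perm (Fin n)) : content (f ∘ w) = content f := by
  funext l
  unfold content
  refine card_bij (fun x _ => w x) ?_ ?_ ?_
  · intro x hx; simpa using hx
  · intro x _ y _ h; exact w.injective h
  · intro y hy; exact ⟨w⁻¹ y, by simpa using hy, by simp⟩

theorem exists_perm_of_content {n : ℕ} {L : Type*} [DecidableEq L] {f g : Fin n → L}
    (h : content f = content g) : ∃ w : Equiv.Perm (Fin n), g ∘ w = f := by
  have e : ∀ l, {x // f x = l} ≃ {x // g x = l} := fun l => by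
    refine Fintype.equivOfCardEq ?_
    rw [Fintype.card_subtype, Fintype.card_subtype]
    exact congrFun h l
  exact ⟨Equiv.ofFiberEquiv e, funext fun x => Equiv.ofFiberEquiv_map e x⟩

theorem comp_sort_of_content {n : ℕ} (q : Composition n) {f : Fin n → Fin q.length}
    (h : content f = q.blocksFun) : f ∘ Tuple.sort f = q.index := by
  rw [← content_index] at h
  obtain ⟨w, hw⟩ := exists_perm_of_content h.symm
  rw [← hw]
  refine Tuple.unique_monotone (Tuple.monotone_sort f) ?_
  rw [hw]
  exact index_mono q

/-- `w` is increasing on every block of `q`. -/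
def Inc {n : ℕ} (q : Composition n) (w : Equiv.Perm (Fin n)) : Prop :=
  ∀ i j, i < j → q.index i = q.index j → w i < w j

theorem inc_iff {n : ℕ} (q : Composition n) (w : Equiv.Perm (Fin n)) :
    Inc q w ↔ w = Tuple.sort (q.index ∘ w.symm) := by
  rw [Tuple.eq_sort_iff]
  have : (q.index ∘ w.symm) ∘ w = q.index := by funext x; simp
  rw [this]
  simp only [Function.comp_apply, Equiv.symm_apply_apply]
  exact ⟨fun h => ⟨index_mono q, h⟩, fun h => h.2⟩

theorem inc_sort {n : ℕ} (q : Composition n) {f : Fin n → Fin q.length}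
    (h : content f = q.blocksFun) : Inc q (Tuple.sort f) := by
  intro i j hij hq
  have h1 := (Tuple.eq_sort_iff (f := f) (σ := Tuple.sort f)).1 rfl
  have h2 := comp_sort_of_content q h
  refine h1.2 i j hij ?_
  have hi := congrFun h2 i
  have hj := congrFun h2 j
  simp only [Function.comp_apply] at hi hj
  rw [hi, hj, hq]

/-- The inversions between different blocks. -/
def outer {n : ℕ} (q : Composition n) (w : Equiv.Perm (Fin n)) : ℕ :=
  #{x : Fin n × Fin n | (x.1 < x.2 ∧ w x.2 < w x.1) ∧ q.index x.1 ≠ q.index x.2}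

theorem outer_le {n : ℕ} (q : Composition n) (w : Equiv.Perm (Fin n)) :
    outer q w ≤ length w :=
  card_le_card fun x hx => by
    simp only [mem_filter, mem_univ, true_and] at hx ⊢
    exact hx.1

theorem inc_iff_outer {n : ℕ} (q : Composition n) (w : Equiv.Perm (Fin n)) :
    Inc q w ↔ length w ≤ outer q w := by
  constructor
  · intro h
    refine card_le_card fun x hx => ?_
    simp only [mem_filter, mem_univ, true_and] at hx ⊢
    exact ⟨hx, fun he => (h _ _ hx.1 he).not_gt hx.2⟩
  · intro h i j hij hq
    by_contra hlt
    have hne : w i ≠ w j := fun he => hij.ne (w.injective he)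
    have hji : w j < w i := lt_of_le_of_ne (not_lt.1 hlt) hne.symm
    refine absurd h (not_le.2 (card_lt_card ?_))
    refine ⟨fun x hx => ?_, fun hsub => ?_⟩
    · simp only [mem_filter, mem_univ, true_and] at hx ⊢
      exact hx.1
    · have := @hsub (i, j) (by simp [hij, hji])
      simp [hq] at this

theorem outer_mul_le {n : ℕ} (q : Composition n) (w h : Equiv.Perm (Fin n))
    (hh : h ∈ youngSubgroup q) : outer q (w * h) ≤ outer q w := by
  have hx' : ∀ x, q.index (h x) = q.index x := hh
  refine card_le_card_of_injOn (fun x => (h x.1, h x.2)) ?_ ?_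
  · intro x hx
    rw [mem_coe, mem_filter] at hx ⊢
    simp only [mem_univ, true_and, Equiv.Perm.coe_mul, Function.comp_apply] at hx ⊢
    obtain ⟨⟨h1, h2⟩, h3⟩ := hx
    refine ⟨⟨?_, h2⟩, by rwa [hx', hx']⟩
    by_contra hle
    have h4 := index_mono q (not_lt.1 hle)
    rw [hx', hx'] at h4
    exact h3 (le_antisymm (index_mono q h1.le) h4)
  · rintro ⟨a, b⟩ _ ⟨c, d⟩ _ hab
    simpa using hab

theorem isMinimal_iff {n : ℕ} (q : Composition n) (w : Equiv.Perm (Fin n)) :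
    IsMinimal q w ↔ Inc q w := by
  constructor
  · intro hmin
    set f : Fin n → Fin q.length := q.index ∘ w.symm with hf
    have hc : content f = q.blocksFun := by
      rw [hf, content_comp_perm, content_index]
    set u := Tuple.sort f with hu
    have hfu : f ∘ u = q.index := comp_sort_of_content q hc
    have hmem : w⁻¹ * u ∈ youngSubgroup q := fun x => congrFun hfu x
    have h1 := hmin _ hmem
    rw [mul_inv_cancel_left] at h1
    have h2 := (inc_iff_outer q u).1 (inc_sort q hc)
    have h3 := outer_mul_le q w _ hmem
    rw [mul_inv_cancel_left] at h3
    exact (inc_iff_outer q w).2 (h1.trans (h2.trans h3))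
  · intro hinc h hh
    have h1 := outer_mul_le q (w * h) h⁻¹ (inv_mem hh)
    rw [mul_inv_cancel_right] at h1
    exact ((inc_iff_outer q w).1 hinc).trans (h1.trans (outer_le q _))

/-- The element of the group algebra given by the standardization of a word. -/
noncomputable def std (R : Type*) [CommRing R] {n : ℕ} {L : Type*} [LinearOrder L]
    (f : Fin n → L) : MonoidAlgebra R (Equiv.Perm (Fin n))ᵐᵒᵖ :=
  MonoidAlgebra.of R _ (op (Tuple.sort f))

theorem Xi_eq (R : Type*) [CommRing R] {n : ℕ} (q : Composition n) :
    Xi R q = ∑ f : Fin n → Fin q.length with content f = q.blocksFun, std R f := by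
  classical
  unfold Xi std
  refine sum_bij' (fun w _ => q.index ∘ w.symm) (fun f _ => Tuple.sort f) ?_ ?_ ?_ ?_ ?_
  · intro w _
    simp only [mem_filter, mem_univ, true_and]
    rw [content_comp_perm, content_index]
  · intro f hf
    simp only [mem_filter, mem_univ, true_and] at hf ⊢
    exact (isMinimal_iff q _).2 (inc_sort q hf)
  · intro w hw
    simp only [mem_filter, mem_univ, true_and] at hw
    exact ((inc_iff q w).1 ((isMinimal_iff q w).1 hw)).symm
  · intro f hf
    simp only [mem_filter, mem_univ, true_and] at hf
    rw [← comp_sort_of_content q hf]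
    funext x
    simp
  · intro w hw
    simp only [mem_filter, mem_univ, true_and] at hw
    rw [← (inc_iff q w).1 ((isMinimal_iff q w).1 hw)]

/-! ### Products of sums over words -/

open Classical in
/-- The matrices with given row and column sums (and entries at most `N`). -/
noncomputable def box {L K : Type*} [Fintype L] [Fintype K] (N : ℕ) (r : L → ℕ) (q : K → ℕ) :
    Finset (L ×ₗ K → ℕ) :=
  {A ∈ Fintype.piFinset fun _ : L ×ₗ K => range (N + 1) |
    (∀ l, ∑ k, A (toLex (l, k)) = r l) ∧ ∀ k, ∑ l, A (toLex (l, k)) = q k}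

theorem sum_box {L K : Type*} [Fintype L] [Fintype K] {N : ℕ} {r : L → ℕ} {q : K → ℕ}
    {A : L ×ₗ K → ℕ} (hA : A ∈ box N r q) : ∑ x, A x = ∑ l, r l := by
  unfold box at hA
  rw [mem_filter] at hA
  calc ∑ x, A x = ∑ x : L × K, A (toLex x) := (Equiv.sum_comp toLex A).symm
    _ = ∑ l, ∑ k, A (toLex (l, k)) := Fintype.sum_prod_type _
    _ = _ := sum_congr rfl fun l _ => hA.2.1 l

open Classical in
theorem conv {L K T₁ T₂ T₃ B : Type*} [Fintype L] [Fintype K] [Fintype T₁] [Fintype T₂]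
    [Fintype T₃] [Semiring B] (c₁ : T₁ → L → ℕ) (c₂ : T₂ → K → ℕ) (c₃ : T₃ → L ×ₗ K → ℕ)
    (v₁ : T₁ → B) (v₂ : T₂ → B) (v₃ : T₃ → B) (e : T₁ × T₂ ≃ T₃) (N : ℕ)
    (hv : ∀ t u, v₁ t * v₂ u = v₃ (e (t, u)))
    (h₁ : ∀ t u l, ∑ k, c₃ (e (t, u)) (toLex (l, k)) = c₁ t l)
    (h₂ : ∀ t u k, ∑ l, c₃ (e (t, u)) (toLex (l, k)) = c₂ u k)
    (hN : ∀ t x, c₃ t x ≤ N) (r : L → ℕ) (q : K → ℕ) :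
    (∑ t with c₁ t = r, v₁ t) * (∑ t with c₂ t = q, v₂ t) =
      ∑ A ∈ box N r q, ∑ t with c₃ t = A, v₃ t := by
  have h3 : ∀ t u, c₃ (e (t, u)) ∈ box N r q ↔ c₁ t = r ∧ c₂ u = q := by
    intro t u
    unfold box
    rw [mem_filter, Fintype.mem_piFinset]
    simp only [h₁, h₂, mem_range, Nat.lt_succ_iff, hN, implies_true, true_and, funext_iff]
  have h4 : ∑ A ∈ box N r q, ∑ t with c₃ t = A, v₃ t = ∑ t with c₃ t ∈ box N r q, v₃ t := by
    rw [← sum_fiberwise_of_maps_to (s := {t | c₃ t ∈ box N r q}) (t := box N r q) (g := c₃)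
      (fun t ht => (mem_filter.1 ht).2)]
    refine sum_congr rfl fun A hA => sum_congr ?_ fun _ _ => rfl
    ext t
    simp only [mem_filter, mem_univ, true_and]
    exact ⟨fun h => ⟨h ▸ hA, h⟩, fun h => h.2⟩
  rw [h4, sum_mul_sum, ← sum_product']
  refine sum_bij (fun x _ => e x) ?_ ?_ ?_ ?_
  · rintro ⟨t, u⟩ hx
    simp only [mem_product, mem_filter, mem_univ, true_and] at hx ⊢
    exact (h3 t u).2 hx
  · intro x _ y _ h
    exact e.injective h
  · intro y hy
    obtain ⟨⟨t, u⟩, rfl⟩ := e.surjective y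
    simp only [mem_filter, mem_univ, true_and] at hy
    exact ⟨(t, u), by simpa using (h3 t u).1 hy, rfl⟩
  · rintro ⟨t, u⟩ _
    exact hv t u

open Classical in
theorem restrict {L K T₁ T₂ B : Type*} [Fintype T₁] [Fintype T₂] [AddCommMonoid B]
    (e : K → L) (j : T₁ → T₂) (hj : Function.Injective j) (c₁ : T₁ → K → ℕ) (c₂ : T₂ → L → ℕ)
    (v₁ : T₁ → B) (v₂ : T₂ → B) (hv : ∀ t, v₂ (j t) = v₁ t)
    (hc : ∀ t i, c₂ (j t) (e i) = c₁ t i) (h0 : ∀ t, ∀ x ∉ Set.range e, c₂ (j t) x = 0)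
    (hs : ∀ t, (∀ x ∉ Set.range e, c₂ t x = 0) → t ∈ Set.range j)
    (a : L → ℕ) (ha : ∀ x ∉ Set.range e, a x = 0) (b : K → ℕ) (hb : ∀ i, a (e i) = b i) :
    ∑ t with c₂ t = a, v₂ t = ∑ t with c₁ t = b, v₁ t := by
  symm
  refine sum_bij (fun t _ => j t) ?_ ?_ ?_ ?_
  · intro t ht
    simp only [mem_filter, mem_univ, true_and] at ht ⊢
    funext x
    by_cases hx : x ∈ Set.range e
    · obtain ⟨i, rfl⟩ := hx
      rw [hc, hb, ht]
    · rw [h0 t x hx, ha x hx]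
  · intro x _ y _ h
    exact hj h
  · intro y hy
    simp only [mem_filter, mem_univ, true_and] at hy
    obtain ⟨t, rfl⟩ := hs y (fun x hx => by rw [hy]; exact ha x hx)
    refine ⟨t, ?_, rfl⟩
    simp only [mem_filter, mem_univ, true_and]
    funext i
    rw [← hc, hy, hb]
  · intro t _
    exact (hv t).symm

section Words

variable {n : ℕ} {L K : Type*} [LinearOrder L] [LinearOrder K]

/-- The product of two words. -/
def wordMul (f : Fin n → L) (g : Fin n → K) (x : Fin n) : L ×ₗ K :=
  toLex (f ((Tuple.sort g).symm x), g x)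

theorem sort_wordMul (f : Fin n → L) (g : Fin n → K) :
    Tuple.sort (wordMul f g) = Tuple.sort g * Tuple.sort f := by
  symm
  have hf := (Tuple.eq_sort_iff (f := f) (σ := Tuple.sort f)).1 rfl
  have hg := (Tuple.eq_sort_iff (f := g) (σ := Tuple.sort g)).1 rfl
  have key : ∀ i, wordMul f g ((Tuple.sort g * Tuple.sort f) i) =
      toLex (f (Tuple.sort f i), g (Tuple.sort g (Tuple.sort f i))) := by
    intro i
    simp [wordMul]
  rw [Tuple.eq_sort_iff]
  constructor
  · intro i j hij
    rcases hij.eq_or_lt with rfl | hlt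
    · exact le_rfl
    · simp only [Function.comp_apply]
      rw [key, key, Prod.Lex.toLex_le_toLex]
      rcases (hf.1 hij).lt_or_eq with h | h
      · exact Or.inl h
      · exact Or.inr ⟨h, hg.1 (hf.2 i j hlt h).le⟩
  · intro i j hij h
    rw [key, key] at h
    have h' := Prod.ext_iff.1 (toLex.injective h)
    exact hg.2 _ _ (hf.2 i j hij h'.1) h'.2

theorem std_mul (R : Type*) [CommRing R] (f : Fin n → L) (g : Fin n → K) :
    std R f * std R g = std R (wordMul f g) := by
  unfold std
  rw [sort_wordMul, ← map_mul, op_mul]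

/-- Pairs of words are words in pairs. -/
def wordEquiv : (Fin n → L) × (Fin n → K) ≃ (Fin n → L ×ₗ K) where
  toFun p := wordMul p.1 p.2
  invFun h := (fun x => (ofLex (h (Tuple.sort (fun y => (ofLex (h y)).2) x))).1,
    fun y => (ofLex (h y)).2)
  left_inv := by
    rintro ⟨f, g⟩
    simp [wordMul]
  right_inv := by
    intro h
    funext x
    simp [wordMul]

theorem content_le {M : Type*} [DecidableEq M] (f : Fin n → M) (l : M) : content f l ≤ n := by
  unfold content
  exact (card_le_univ _).trans (by simp)

theorem sum_content {M : Type*} [DecidableEq M] [Fintype M] (f : Fin n → M) :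
    ∑ l, content f l = n := by
  unfold content
  rw [← card_eq_sum_card_fiberwise (fun _ _ => by simp)]
  simp

theorem sum_content_right [Fintype K] (f : Fin n → L) (g : Fin n → K) (l : L) :
    ∑ k, content (fun x => toLex (f x, g x)) (toLex (l, k)) = content f l := by
  unfold content
  rw [card_eq_sum_card_fiberwise (f := g) (t := univ) (fun _ _ => by simp)]
  refine sum_congr rfl fun k _ => ?_
  rw [filter_filter]
  congr 1
  ext x
  simp only [mem_filter, mem_univ, true_and, EmbeddingLike.apply_eq_iff_eq, Prod.mk.injEq]

theorem sum_content_left [Fintype L] (f : Fin n → L) (g : Fin n → K) (k : K) :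
    ∑ l, content (fun x => toLex (f x, g x)) (toLex (l, k)) = content g k := by
  unfold content
  rw [card_eq_sum_card_fiberwise (f := f) (t := univ) (fun _ _ => by simp)]
  refine sum_congr rfl fun l _ => ?_
  rw [filter_filter]
  congr 1
  ext x
  simp only [mem_filter, mem_univ, true_and, EmbeddingLike.apply_eq_iff_eq, Prod.mk.injEq,
    and_comm]

theorem sort_comp {f : Fin n → K} (e : K ↪o L) : Tuple.sort (e ∘ f) = Tuple.sort f := by
  symm
  have hf := (Tuple.eq_sort_iff (f := f) (σ := Tuple.sort f)).1 rfl
  rw [Tuple.eq_sort_iff]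
  refine ⟨fun i j hij => e.monotone (hf.1 hij), fun i j hij h => hf.2 i j hij (e.injective h)⟩

theorem content_comp {f : Fin n → K} (e : K ↪o L) (i : K) :
    content (e ∘ f) (e i) = content f i := by
  simp [content]

theorem content_comp_zero {f : Fin n → K} (e : K ↪o L) (x : L) (hx : x ∉ Set.range e) :
    content (e ∘ f) x = 0 := by
  simp only [content, card_eq_zero, filter_eq_empty_iff, mem_univ, true_implies]
  exact fun y h => hx ⟨_, h⟩

theorem exists_comp (e : K ↪o L) (f : Fin n → L) (h : ∀ x ∉ Set.range e, content f x = 0) :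
    ∃ g : Fin n → K, e ∘ g = f := by
  have : ∀ y, ∃ k, e k = f y := by
    intro y
    by_contra hy
    have := h (f y) (fun ⟨k, hk⟩ => hy ⟨k, hk⟩)
    simp only [content, card_eq_zero, filter_eq_empty_iff, mem_univ, true_implies] at this
    exact this rfl
  choose g hg using this
  exact ⟨g, funext hg⟩

end Words

/-! ### The three sums -/

section Sums

variable (R : Type*) [CommRing R]

/-- The sum of the words of content `a`. -/
noncomputable def X (n : ℕ) {L : Type*} [LinearOrder L] [Fintype L] (a : L → ℕ) :
    MonoidAlgebra R (Equiv.Perm (Fin n))ᵐᵒᵖ :=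
  ∑ f : Fin n → L with content f = a, std R f

/-- The content of a word in which one letter `l` is counted `s` more times. -/
def contentAdd (s : ℕ) {n : ℕ} {L : Type*} [DecidableEq L] (p : (Fin n → L) × L) (x : L) : ℕ :=
  content p.1 x + if p.2 = x then s else 0

/-- The sum of the words that have content `a` when one letter is counted `s` more times. -/
noncomputable def Y (n s : ℕ) {L : Type*} [LinearOrder L] [Fintype L] (a : L → ℕ) :
    MonoidAlgebra R (Equiv.Perm (Fin n))ᵐᵒᵖ :=
  ∑ p : (Fin n → L) × L with contentAdd s p = a, std R p.1

open Classical in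
/-- The number of `σ`-invariant words of content `a`. -/
noncomputable def Z {n : ℕ} (σ : Equiv.Perm (Fin n)) {L : Type*} [LinearOrder L] [Fintype L]
    (a : L → ℕ) : R :=
  ∑ f : {f : Fin n → L // f ∘ σ = f} with content f.1 = a, 1

variable {L K : Type*} [LinearOrder L] [Fintype L] [LinearOrder K] [Fintype K]

theorem X_mul (n : ℕ) (r : L → ℕ) (q : K → ℕ) (N : ℕ) (hN : n ≤ N) :
    X R n r * X R n q = ∑ A ∈ box N r q, X R n A := by
  classical
  have h := conv (fun f : Fin n → L => content f) (fun f : Fin n → K => content f)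
    (fun f : Fin n → L ×ₗ K => content f) (std R) (std R) (std R) wordEquiv N
    (fun f g => std_mul R f g)
    (fun f g l => (sum_content_right _ g l).trans (by rw [← content_comp_perm f]; rfl))
    (fun f g k => sum_content_left _ g k)
    (fun f x => (content_le f x).trans hN) r q
  unfold X
  convert h

theorem Y_mul (n s : ℕ) (r : L → ℕ) (q : K → ℕ) (N : ℕ) (hN : n + s ≤ N) :
    Y R n s r * Y R n s q = ∑ A ∈ box N r q, Y R n s A := by
  classical
  have e : ∀ l k l' k', ((toLex (l, k) : L ×ₗ K) = toLex (l', k')) ↔ l = l' ∧ k = k' := by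
    intros; simp
  have h := conv (contentAdd s (n := n) (L := L)) (contentAdd s (n := n) (L := K))
    (contentAdd s (n := n) (L := L ×ₗ K)) (fun p => std R p.1) (fun p => std R p.1)
    (fun p => std R p.1)
    ((Equiv.prodProdProdComm _ _ _ _).trans (wordEquiv.prodCongr toLex)) N
    (fun f g => std_mul R f.1 g.1)
    (fun f g l => by
      have h1 := (sum_content_right (f.1 ∘ (Tuple.sort g.1).symm) g.1 l)
      rw [content_comp_perm] at h1
      simp only [contentAdd, sum_add_distrib]
      refine congrArg₂ (· + ·) h1 ?_
      simp [Equiv.prodProdProdComm, ite_and])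
    (fun f g k => by
      have h1 := (sum_content_left (f.1 ∘ (Tuple.sort g.1).symm) g.1 k)
      simp only [contentAdd, sum_add_distrib]
      refine congrArg₂ (· + ·) h1 ?_
      simp [Equiv.prodProdProdComm, ite_and])
    (fun f x => (add_le_add (content_le f.1 x) (by split_ifs <;> simp)).trans hN) r q
  unfold Y
  convert h

theorem Z_mul {n : ℕ} (σ : Equiv.Perm (Fin n)) (r : L → ℕ) (q : K → ℕ) (N : ℕ) (hN : n ≤ N) :
    Z R σ r * Z R σ q = ∑ A ∈ box N r q, Z R σ A := by
  classical
  have h := conv (fun f : {f : Fin n → L // f ∘ σ = f} => content f.1)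
    (fun f : {f : Fin n → K // f ∘ σ = f} => content f.1)
    (fun f : {f : Fin n → L ×ₗ K // f ∘ σ = f} => content f.1)
    (fun _ => (1 : R)) (fun _ => (1 : R)) (fun _ => (1 : R))
    { toFun := fun p => ⟨fun x => toLex (p.1.1 x, p.2.1 x), funext fun x =>
        congrArg toLex (Prod.ext (congrFun p.1.2 x) (congrFun p.2.2 x))⟩
      invFun := fun f => (⟨fun x => (ofLex (f.1 x)).1, funext fun x =>
        congrArg (fun y => (ofLex y).1) (congrFun f.2 x)⟩, ⟨fun x => (ofLex (f.1 x)).2,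
        funext fun x => congrArg (fun y => (ofLex y).2) (congrFun f.2 x)⟩)
      left_inv := fun _ => rfl
      right_inv := fun _ => rfl } N
    (fun _ _ => one_mul 1)
    (fun f g l => sum_content_right f.1 g.1 l)
    (fun f g k => sum_content_left f.1 g.1 k)
    (fun f x => (content_le f.1 x).trans hN) r q
  unfold Z
  convert h

theorem X_restrict (n : ℕ) (e : K ↪o L) (a : L → ℕ) (ha : ∀ x ∉ Set.range e, a x = 0)
    (b : K → ℕ) (hb : ∀ i, a (e i) = b i) : X R n a = X R n b := by
  classical
  have h := restrict e (fun f : Fin n → K => e ∘ f) (e.injective.comp_left)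
    (fun f => content f) (fun f => content f) (std R) (std R)
    (fun f => by unfold std; rw [sort_comp]) (fun f i => content_comp e i)
    (fun f x hx => content_comp_zero e x hx) (fun f hf => exists_comp e f hf) a ha b hb
  unfold X
  convert h

theorem Y_restrict (n s : ℕ) (hs : 0 < s) (e : K ↪o L) (a : L → ℕ)
    (ha : ∀ x ∉ Set.range e, a x = 0)
    (b : K → ℕ) (hb : ∀ i, a (e i) = b i) : Y R n s a = Y R n s b := by
  classical
  have h := restrict e (fun p : (Fin n → K) × K => (e ∘ p.1, e p.2))
    (Function.Injective.prodMap e.injective.comp_left e.injective)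
    (contentAdd s) (contentAdd s) (fun p => std R p.1) (fun p => std R p.1)
    (fun f => by simp only [std]; rw [sort_comp])
    (fun f i => by simp [contentAdd, content_comp])
    (fun f x hx => by
      have : e f.2 ≠ x := fun h => hx ⟨_, h⟩
      simp [contentAdd, content_comp_zero e x hx, this])
    (fun f hf => by
      simp only [contentAdd, Nat.add_eq_zero_iff] at hf
      obtain ⟨g, hg⟩ := exists_comp e f.1 (fun x hx => (hf x hx).1)
      by_cases hk : f.2 ∈ Set.range e
      · obtain ⟨k, hk⟩ := hk
        exact ⟨(g, k), Prod.ext hg hk⟩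
      · have := (hf _ hk).2
        simp at this
        omega) a ha b hb
  unfold Y
  convert h

theorem Z_restrict {n : ℕ} (σ : Equiv.Perm (Fin n)) (e : K ↪o L) (a : L → ℕ)
    (ha : ∀ x ∉ Set.range e, a x = 0)
    (b : K → ℕ) (hb : ∀ i, a (e i) = b i) : Z R σ a = Z R σ b := by
  classical
  have h := restrict e (fun f : {f : Fin n → K // f ∘ σ = f} =>
      (⟨e ∘ f.1, congrArg (e ∘ ·) f.2⟩ : {f : Fin n → L // f ∘ σ = f}))
    (fun f g hfg => Subtype.ext (e.injective.comp_left (congrArg Subtype.val hfg)))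
    (fun f => content f.1) (fun f => content f.1) (fun _ => (1 : R)) (fun _ => (1 : R))
    (fun f => rfl) (fun f i => content_comp e i)
    (fun f x hx => content_comp_zero e x hx) (fun f hf => by
      obtain ⟨g, hg⟩ := exists_comp e f.1 hf
      refine ⟨⟨g, ?_⟩, Subtype.ext hg⟩
      have := f.2
      rw [← hg] at this
      exact e.injective.comp_left this) a ha b hb
  unfold Z
  convert h

end Sums

/-! ### Compositions from sequences with zeros -/

/-- The composition of `n` obtained from `q` (a composition of `n + s`) by subtracting `s` from
the part with index `i`, and removing this part if it has become zero. -/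
def subPart {n s : ℕ} (q : Composition (n + s)) (i : Fin q.length) (h : s ≤ q.blocksFun i) :
    Composition n where
  blocks := (List.ofFn fun j => if j = i then q.blocksFun j - s else q.blocksFun j).filter
    (fun b => 0 < b)
  blocks_pos := fun hb => by simpa using (List.mem_filter.1 hb).2
  blocks_sum := by
    have h1 : ∀ l : List ℕ, (l.filter (fun b => 0 < b)).sum = l.sum := by
      intro l
      induction l with
      | nil => rfl
      | cons a l ih =>
        rw [List.filter_cons, List.sum_cons]
        split_ifs with ha
        · rw [List.sum_cons, ih]
        · rw [ih]
          simp at ha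
          omega
    rw [h1, List.sum_ofFn]
    have h2 : ∑ j, ((if j = i then q.blocksFun j - s else q.blocksFun j) +
        if j = i then s else 0) = n + s := by
      refine Eq.trans ?_ q.sum_blocksFun
      refine sum_congr rfl fun j _ => ?_
      split_ifs with hj
      · subst hj
        omega
      · rfl
    rw [sum_add_distrib, sum_ite_eq' univ i (fun _ => s), if_pos (mem_univ i)] at h2
    omega

theorem zero_off_range {K L : Type*} [Fintype K] [Fintype L] (e : K ↪ L) (a : L → ℕ) (b : K → ℕ)
    (hb : ∀ i, a (e i) = b i) (h : ∑ x, a x = ∑ i, b i) : ∀ x ∉ Set.range e, a x = 0 := by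
  classical
  have h1 : ∑ i, b i = ∑ x ∈ univ.map e, a x := by
    rw [sum_map]
    exact sum_congr rfl fun i _ => (hb i).symm
  have h2 := sum_compl_add_sum (univ.map e) a
  have h3 : ∑ x ∈ (univ.map e)ᶜ, a x = 0 := by omega
  intro x hx
  refine (sum_eq_zero_iff.1 h3) x ?_
  simpa using hx

theorem subPart_embedding {n s : ℕ} (q : Composition (n + s)) (i : Fin q.length)
    (h : s ≤ q.blocksFun i) : ∃ e : Fin (subPart q i h).length ↪o Fin q.length,
      (∀ j, (if e j = i then q.blocksFun (e j) - s else q.blocksFun (e j)) =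
        (subPart q i h).blocksFun j) := by
  set a : Fin q.length → ℕ := fun j => if j = i then q.blocksFun j - s else q.blocksFun j with ha
  have hsub : (subPart q i h).blocks.Sublist (List.ofFn a) := List.filter_sublist
  obtain ⟨f, hf⟩ := List.sublist_iff_exists_fin_orderEmbedding_get_eq.1 hsub
  refine ⟨f.trans (Fin.castOrderIso (List.length_ofFn)).toOrderEmbedding, fun j => ?_⟩
  have h1 := hf j
  rw [List.get_ofFn] at h1
  exact h1.symm

theorem exists_composition {n : ℕ} {L : Type*} [LinearOrder L] [Fintype L] (a : L → ℕ)
    (ha : ∑ x, a x = n) : ∃ (q : Composition n) (e : Fin q.length ↪o L),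
      (∀ i, a (e i) = q.blocksFun i) ∧ ∀ x ∉ Set.range e, a x = 0 := by
  classical
  set S : Finset L := {x | a x ≠ 0} with hS
  set f : Fin #S ↪o L := S.orderEmbOfFin rfl with hf
  have hsum : ∑ i, a (f i) = n := by
    rw [← ha, ← sum_subset (subset_univ S) (f := a)
      (fun x _ hx => by simpa [hS] using hx)]
    rw [← sum_coe_sort S a]
    exact Equiv.sum_comp (S.orderIsoOfFin rfl).toEquiv (fun x : S => a x)
  let q : Composition n :=
    { blocks := List.ofFn fun i => a (f i)
      blocks_pos := fun {b} hb => by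
        obtain ⟨i, rfl⟩ := (List.mem_ofFn' _ _).1 hb
        have := S.orderEmbOfFin_mem rfl i
        simp only [hS, mem_filter, mem_univ, true_and] at this
        exact Nat.pos_of_ne_zero this
      blocks_sum := by rw [List.sum_ofFn]; exact hsum }
  have key : ∀ i, a (((Fin.castOrderIso (List.length_ofFn)).toOrderEmbedding.trans f) i) =
      q.blocksFun i := by
    intro i
    have : q.blocksFun i = q.blocks.get i := rfl
    rw [this, List.get_ofFn]
    rfl
  refine ⟨q, (Fin.castOrderIso (List.length_ofFn)).toOrderEmbedding.trans f, key, ?_⟩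
  exact zero_off_range (RelEmbedding.toEmbedding _) a _ key (by rw [q.sum_blocksFun, ha])

/-! ### Linear independence -/

section Independent

theorem index_surjective {n : ℕ} (q : Composition n) : Function.Surjective q.index := fun i =>
  ⟨q.embedding i ⟨0, q.one_le_blocksFun i⟩, q.index_embedding i _⟩

/-- A permutation whose descents are exactly at the ends of the blocks of `q`. -/
def rep {n : ℕ} (q : Composition n) : Equiv.Perm (Fin n) :=
  (Tuple.sort (OrderDual.toDual ∘ q.index)).symm

theorem rep_lt {n : ℕ} (q : Composition n) {x y : Fin n} (h : x < y) :
    rep q x < rep q y ↔ q.index x = q.index y := by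
  have hs := (Tuple.eq_sort_iff (f := OrderDual.toDual ∘ q.index)
    (σ := Tuple.sort (OrderDual.toDual ∘ q.index))).1 rfl
  set t := Tuple.sort (OrderDual.toDual ∘ q.index) with ht
  have ex : t (rep q x) = x := t.apply_symm_apply x
  have ey : t (rep q y) = y := t.apply_symm_apply y
  constructor
  · intro hlt
    have h1 := hs.1 hlt.le
    simp only [Function.comp_apply, ex, ey, OrderDual.toDual_le_toDual] at h1
    exact le_antisymm (index_mono q h.le) h1
  · intro he
    by_contra hlt
    have hne : rep q y ≠ rep q x := fun h' => h.ne' ((rep q).injective h')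
    have h2 := hs.2 _ _ (lt_of_le_of_ne (not_lt.1 hlt) hne)
      (by simp only [Function.comp_apply, ex, ey, he])
    rw [ex, ey] at h2
    exact h2.not_gt h

theorem inc_rep {n : ℕ} (q r : Composition n) : Inc r (rep q) ↔
    ∀ x y, r.index x = r.index y → q.index x = q.index y := by
  constructor
  · intro h x y hxy
    rcases lt_trichotomy x y with hlt | rfl | hlt
    · exact (rep_lt q hlt).1 (h x y hlt hxy)
    · rfl
    · exact ((rep_lt q hlt).1 (h y x hlt hxy.symm)).symm
  · intro h i j hij hr
    exact (rep_lt q hij).2 (h i j hr)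

theorem eq_of_refines {n : ℕ} (q r : Composition n)
    (h : ∀ x y, r.index x = r.index y → q.index x = q.index y) (hl : r.length ≤ q.length) :
    r = q := by
  choose g hg using index_surjective r
  set φ : Fin r.length → Fin q.length := fun i => q.index (g i) with hφ
  have hφi : ∀ x, φ (r.index x) = q.index x := fun x => h _ _ (hg _)
  have hsurj : Function.Surjective φ := by
    intro j
    obtain ⟨x, rfl⟩ := index_surjective q j
    exact ⟨r.index x, hφi x⟩
  have hlen : r.length = q.length :=
    le_antisymm hl (by simpa using Fintype.card_le_of_surjective φ hsurj)
  have hbij : Function.Bijective φ :=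
    (Fintype.bijective_iff_surjective_and_card φ).2 ⟨hsurj, by simp [hlen]⟩
  have hmono : Monotone φ := by
    intro i j hij
    obtain ⟨x, rfl⟩ := index_surjective r i
    obtain ⟨y, rfl⟩ := index_surjective r j
    rw [hφi, hφi]
    rcases hij.lt_or_eq with hlt | he
    · refine index_mono q ?_
      by_contra hyx
      exact hlt.not_ge (index_mono r (not_le.1 hyx).le)
    · exact (h _ _ he).le
  have hcast : ∀ i, φ i = Fin.cast hlen i := by
    have h1 : (hmono.strictMono_of_injective hbij.1).orderIsoOfSurjective φ hsurj =
      Fin.castOrderIso hlen := Subsingleton.elim _ _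
    intro i
    exact DFunLike.congr_fun h1 i
  refine Composition.ext (List.ext_get (by rw [r.blocks_length, q.blocks_length, hlen]) ?_)
  intro k h1 h2
  have e1 : r.blocks.get ⟨k, h1⟩ = content r.index ⟨k, h1⟩ := by rw [content_index]; rfl
  have e2 : q.blocks.get ⟨k, h2⟩ = content q.index ⟨k, h2⟩ := by rw [content_index]; rfl
  rw [e1, e2]
  unfold content
  congr 1
  ext x
  simp only [mem_filter, mem_univ, true_and]
  rw [← hφi x, hcast]
  simp only [Fin.ext_iff, Fin.val_cast]

theorem coeff_Xi (R : Type*) [CommRing R] {n : ℕ} (r : Composition n) (w : Equiv.Perm (Fin n))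
    [Decidable (Inc r w)] : (Xi R r).coeff (op w) = if Inc r w then 1 else 0 := by
  classical
  unfold Xi
  simp only [MonoidAlgebra.coeff_sum, MonoidAlgebra.of_apply, MonoidAlgebra.coeff_single,
    Finsupp.finsetSum_apply, Finsupp.single_apply, op_inj]
  rw [sum_ite_eq']
  simp [isMinimal_iff]

theorem linearIndependent_Xi (R : Type*) [CommRing R] (n : ℕ) :
    LinearIndependent R (fun q : Composition n => Xi R q) := by
  classical
  rw [Fintype.linearIndependent_iff]
  intro c hc
  have key : ∀ q : Composition n, ∑ r, c r * (if Inc r (rep q) then 1 else 0) = 0 := by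
    intro q
    have h1 := congrArg (fun x => x.coeff (op (rep q))) hc
    simpa [MonoidAlgebra.coeff_sum, Finsupp.finsetSum_apply, coeff_Xi] using h1
  have main : ∀ d : ℕ, ∀ q : Composition n, n ≤ q.length + d → c q = 0 := by
    intro d
    induction d with
    | zero =>
      intro q hq
      have h1 := key q
      rw [sum_eq_single q] at h1
      · rwa [if_pos ((inc_rep q q).2 fun _ _ h => h), mul_one] at h1
      · intro r _ hr
        rw [if_neg, mul_zero]
        intro hi
        exact hr (eq_of_refines q r ((inc_rep q r).1 hi) (r.length_le.trans hq))
      · simp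
    | succ d ih =>
      intro q hq
      have h1 := key q
      rw [sum_eq_single q] at h1
      · rwa [if_pos ((inc_rep q q).2 fun _ _ h => h), mul_one] at h1
      · intro r _ hr
        by_cases hi : Inc r (rep q)
        · have hlt : q.length < r.length := by
            by_contra hle
            exact hr (eq_of_refines q r ((inc_rep q r).1 hi) (not_lt.1 hle))
          rw [ih r (by omega), zero_mul]
        · rw [if_neg hi, mul_zero]
      · simp
  exact fun q => main n q (by omega)

end Independent

/-! ### The descent algebra -/

section Algebra

variable (R : Type*) [CommRing R]

theorem Xi_eq_X {n : ℕ} (q : Composition n) : Xi R q = X R n q.blocksFun := Xi_eq R q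

theorem X_mem {n : ℕ} {L : Type*} [LinearOrder L] [Fintype L] (a : L → ℕ) (ha : ∑ x, a x = n) :
    X R n a ∈ Submodule.span R (Set.range fun q : Composition n => Xi R q) := by
  obtain ⟨q, e, h1, h2⟩ := exists_composition a ha
  rw [X_restrict R n e a h2 _ h1, ← Xi_eq_X]
  exact Submodule.subset_span ⟨q, rfl⟩

theorem one_eq_X (n : ℕ) :
    (1 : MonoidAlgebra R (Equiv.Perm (Fin n))ᵐᵒᵖ) = X R n (fun _ : Fin 1 => n) := by
  classical
  unfold X
  have h1 : ({f | content f = fun _ => n} : Finset (Fin n → Fin 1)) = {fun _ => 0} := by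
    ext f
    have hf : f = fun _ => 0 := Subsingleton.elim _ _
    subst hf
    simp only [mem_filter, mem_univ, true_and, mem_singleton, iff_true]
    funext l
    have : l = 0 := Subsingleton.elim _ _
    subst this
    simp [content]
  have h2 : Tuple.sort (fun _ : Fin n => (0 : Fin 1)) = 1 :=
    Tuple.sort_eq_refl_iff_monotone.2 monotone_const
  rw [h1, sum_singleton, std, h2, op_one, map_one]

theorem one_mem_span (n : ℕ) : (1 : MonoidAlgebra R (Equiv.Perm (Fin n))ᵐᵒᵖ) ∈
    Submodule.span R (Set.range fun q : Composition n => Xi R q) := by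
  rw [one_eq_X]
  exact X_mem R _ (by simp)

theorem mul_mem_span {n : ℕ} {a b : MonoidAlgebra R (Equiv.Perm (Fin n))ᵐᵒᵖ}
    (ha : a ∈ Submodule.span R (Set.range fun q : Composition n => Xi R q))
    (hb : b ∈ Submodule.span R (Set.range fun q : Composition n => Xi R q)) :
    a * b ∈ Submodule.span R (Set.range fun q : Composition n => Xi R q) := by
  refine Submodule.span_induction₂ (p := fun a b _ _ =>
    a * b ∈ Submodule.span R (Set.range fun q : Composition n => Xi R q)) ?_ ?_ ?_ ?_ ?_ ?_ ?_ ha hb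
  · rintro _ _ ⟨r, rfl⟩ ⟨q, rfl⟩
    simp only [Xi_eq_X R r, Xi_eq_X R q]
    rw [X_mul R n _ _ n le_rfl]
    refine Submodule.sum_mem _ fun A hA => X_mem R A ?_
    rw [sum_box hA, r.sum_blocksFun]
  · intro y _
    rw [zero_mul]
    exact Submodule.zero_mem _
  · intro x _
    rw [mul_zero]
    exact Submodule.zero_mem _
  · intro x y z _ _ _ h1 h2
    rw [add_mul]
    exact Submodule.add_mem _ h1 h2
  · intro x y z _ _ _ h1 h2
    rw [mul_add]
    exact Submodule.add_mem _ h1 h2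
  · intro c x y _ _ h
    rw [smul_mul_assoc]
    exact Submodule.smul_mem _ c h
  · intro c x y _ _ h
    rw [mul_smul_comm]
    exact Submodule.smul_mem _ c h

/-- The descent algebra of the symmetric group of degree `n` over `R`: the span of the elements
`Ξ^q` in the group algebra. -/
noncomputable def descentAlgebra (n : ℕ) :
    Subalgebra R (MonoidAlgebra R (Equiv.Perm (Fin n))ᵐᵒᵖ) :=
  (Submodule.span R (Set.range fun q : Composition n => Xi R q)).toSubalgebra
    (one_mem_span R n) (fun _ _ => mul_mem_span R)

/-- The element `Ξ^q` of the descent algebra. -/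
noncomputable def xi {n : ℕ} (q : Composition n) : descentAlgebra R n :=
  ⟨Xi R q, Submodule.subset_span ⟨q, rfl⟩⟩

/-- The basis of the descent algebra formed by the elements `Ξ^q`. -/
noncomputable def xiBasis (n : ℕ) : Module.Basis (Composition n) R (descentAlgebra R n) :=
  Module.Basis.span (linearIndependent_Xi R n)

theorem xiBasis_apply {n : ℕ} (q : Composition n) : xiBasis R n q = xi R q :=
  Module.Basis.span_apply (linearIndependent_Xi R n) q

/-- A linear map on the descent algebra given by a multiplicative rule is multiplicative. -/
theorem constr_mul {n : ℕ} {B : Type*} [Ring B] [Algebra R B] (W : Composition n → B)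
    (V : ∀ {k : ℕ}, (Fin k → ℕ) → B) (V' : ∀ {k l : ℕ}, (Fin k ×ₗ Fin l → ℕ) → B) (N : ℕ)
    (hN : n ≤ N) (hW : ∀ q : Composition n, W q = V q.blocksFun)
    (hV : ∀ {k l : ℕ} (r : Fin k → ℕ) (q : Fin l → ℕ), V r * V q = ∑ A ∈ box N r q, V' A)
    (hV' : ∀ {k l : ℕ} (A : Fin k ×ₗ Fin l → ℕ) (q : Composition n)
      (e : Fin q.length ↪o Fin k ×ₗ Fin l), (∀ i, A (e i) = q.blocksFun i) →
      (∀ x ∉ Set.range e, A x = 0) → V' A = V q.blocksFun)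
    (x y : descentAlgebra R n) :
    (xiBasis R n).constr R W (x * y) = (xiBasis R n).constr R W x * (xiBasis R n).constr R W y := by
  set F := (xiBasis R n).constr R W with hF
  have hFxi : ∀ q, F (xi R q) = V q.blocksFun := by
    intro q
    rw [← hW, ← xiBasis_apply, hF, Module.Basis.constr_basis]
  have hbil : (LinearMap.mul R (descentAlgebra R n)).compr₂ F =
      (LinearMap.mul R B).compl₁₂ F F := by
    refine (xiBasis R n).ext fun r => (xiBasis R n).ext fun q => ?_
    simp only [LinearMap.compr₂_apply, LinearMap.mul_apply', LinearMap.compl₁₂_apply,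
      xiBasis_apply, hFxi, hV]
    have hex : ∀ A : Fin r.length ×ₗ Fin q.length → ℕ, A ∈ box N r.blocksFun q.blocksFun →
        ∃ t : descentAlgebra R n, (t : MonoidAlgebra R (Equiv.Perm (Fin n))ᵐᵒᵖ) = X R n A ∧
          F t = V' A := by
      intro A hA
      obtain ⟨s, e, h1, h2⟩ := exists_composition A ((sum_box hA).trans r.sum_blocksFun)
      refine ⟨xi R s, ?_, ?_⟩
      · rw [X_restrict R n e A h2 _ h1, ← Xi_eq_X]
        rfl
      · rw [hFxi, hV' A s e h1 h2]
    choose! t ht using hex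
    have hprod : xi R r * xi R q = ∑ A ∈ box N r.blocksFun q.blocksFun, t A := by
      apply Subtype.ext
      rw [MulMemClass.coe_mul, AddSubmonoidClass.coe_finsetSum]
      rw [sum_congr rfl fun A hA => (ht A hA).1, ← X_mul R n _ _ N hN, ← Xi_eq_X, ← Xi_eq_X]
      rfl
    rw [hprod, map_sum]
    exact sum_congr rfl fun A hA => (ht A hA).2
  exact LinearMap.congr_fun (LinearMap.congr_fun hbil x) y

end Algebra

/-! ### The Bergeron-Garsia-Reutenauer map -/

section BGR

open CategoryTheory

variable (R : Type*) [CommRing R]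

theorem constr_one {n : ℕ} {B : Type*} [Ring B] [Algebra R B] (W : Composition n → B) (b : B)
    (hW : ∀ (q : Composition n) (e : Fin q.length ↪o Fin 1), (∀ i, n = q.blocksFun i) →
      (∀ x ∉ Set.range e, n = 0) → W q = b) :
    (xiBasis R n).constr R W 1 = b := by
  obtain ⟨q, e, h1, h2⟩ := exists_composition (n := n) (fun _ : Fin 1 => n) (by simp)
  have h3 : (1 : descentAlgebra R n) = xi R q := by
    apply Subtype.ext
    change (1 : MonoidAlgebra R (Equiv.Perm (Fin n))ᵐᵒᵖ) = Xi R q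
    rw [one_eq_X, Xi_eq_X]
    exact X_restrict R n e _ h2 _ h1
  rw [h3, ← xiBasis_apply, Module.Basis.constr_basis]
  exact hW q e h1 h2

/-- The linear map `Δ_s`, with `Δ_s(Ξ^q) = ∑ Ξ^{q^{(i)}}` over the indices `i` with `qᵢ ≥ s`. -/
noncomputable def bgrLinear (n s : ℕ) : descentAlgebra R (n + s) →ₗ[R] descentAlgebra R n :=
  (xiBasis R (n + s)).constr R fun q =>
    ∑ i : {i : Fin q.length // s ≤ q.blocksFun i}, xi R (subPart q i.1 i.2)

theorem bgrLinear_xi (n s : ℕ) (q : Composition (n + s)) : bgrLinear R n s (xi R q) =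
    ∑ i : {i : Fin q.length // s ≤ q.blocksFun i}, xi R (subPart q i.1 i.2) := by
  rw [← xiBasis_apply, bgrLinear, Module.Basis.constr_basis]

theorem Y_eq (n s : ℕ) (q : Composition (n + s)) :
    ∑ i : {i : Fin q.length // s ≤ q.blocksFun i}, Xi R (subPart q i.1 i.2) =
      Y R n s q.blocksFun := by
  classical
  have h1 : ∀ i : {i : Fin q.length // s ≤ q.blocksFun i}, Xi R (subPart q i.1 i.2) =
      X R n (fun j => if j = i.1 then q.blocksFun j - s else q.blocksFun j) := by
    rintro ⟨i, hi⟩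
    obtain ⟨e, he⟩ := subPart_embedding q i hi
    rw [Xi_eq_X]
    symm
    refine X_restrict R n e _ (zero_off_range e.toEmbedding _ _ he ?_) _ he
    rw [(subPart q i hi).sum_blocksFun]
    have h2 : ∑ j, ((if j = i then q.blocksFun j - s else q.blocksFun j) +
        if j = i then s else 0) = n + s := by
      refine Eq.trans ?_ q.sum_blocksFun
      refine sum_congr rfl fun j _ => ?_
      split_ifs with hj
      · subst hj
        omega
      · rfl
    rw [sum_add_distrib, sum_ite_eq' univ i (fun _ => s), if_pos (mem_univ i)] at h2
    exact Nat.add_right_cancel h2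
  rw [sum_congr rfl fun i _ => h1 i]
  unfold X Y
  rw [sum_sigma']
  refine sum_bij (fun x _ => (x.2, x.1.1)) ?_ ?_ ?_ ?_
  · rintro ⟨⟨i, hi⟩, f⟩ hx
    simp only [mem_sigma, mem_filter, mem_univ, true_and] at hx ⊢
    funext j
    simp only [contentAdd, hx]
    by_cases hj : j = i
    · subst hj
      simp only [if_true]
      omega
    · simp [hj, Ne.symm hj]
  · rintro ⟨⟨i, hi⟩, f⟩ _ ⟨⟨j, hj⟩, g⟩ _ h
    simp only [Prod.mk.injEq] at h
    obtain ⟨rfl, rfl⟩ := h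
    rfl
  · rintro ⟨f, i⟩ hy
    simp only [mem_filter, mem_univ, true_and] at hy
    have hi : s ≤ q.blocksFun i := by
      have := congrFun hy i
      simp only [contentAdd, if_true] at this
      omega
    refine ⟨⟨⟨i, hi⟩, f⟩, ?_, rfl⟩
    simp only [mem_sigma, mem_filter, mem_univ, true_and]
    funext j
    have := congrFun hy j
    simp only [contentAdd] at this
    by_cases hj : j = i
    · subst hj
      simp only [if_true] at this ⊢
      omega
    · simp only [Ne.symm hj, if_false, add_zero] at this
      simp [hj, this]
  · intro x _
    rfl

theorem coe_bgrLinear (n s : ℕ) (x : descentAlgebra R (n + s)) :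
    (bgrLinear R n s x : MonoidAlgebra R (Equiv.Perm (Fin n))ᵐᵒᵖ) =
      (xiBasis R (n + s)).constr R (fun q => Y R n s q.blocksFun) x := by
  have h : (descentAlgebra R n).val.toLinearMap ∘ₗ bgrLinear R n s =
      (xiBasis R (n + s)).constr R (fun q => Y R n s q.blocksFun) := by
    refine (xiBasis R (n + s)).ext fun q => ?_
    rw [Module.Basis.constr_basis, ← Y_eq, LinearMap.comp_apply, xiBasis_apply, bgrLinear_xi,
      map_sum]
    rfl
  exact LinearMap.congr_fun h x

theorem bgrLinear_one (n s : ℕ) (hs : 0 < s) : bgrLinear R n s 1 = 1 := by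
  classical
  apply Subtype.ext
  rw [coe_bgrLinear]
  refine constr_one R _ _ fun q e h1 h2 => ?_
  rw [← Y_restrict R n s hs e (fun _ : Fin 1 => n + s) h2 _ h1]
  change _ = (1 : MonoidAlgebra R (Equiv.Perm (Fin n))ᵐᵒᵖ)
  rw [one_eq_X]
  unfold X Y
  refine sum_bij (fun p _ => p.1) ?_ ?_ ?_ ?_
  · intro p hp
    simp only [mem_filter, mem_univ, true_and] at hp ⊢
    funext x
    have := congrFun hp x
    rw [contentAdd, if_pos (Subsingleton.elim _ _)] at this
    omega
  · intro p _ p' _ h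
    exact Prod.ext h (Subsingleton.elim _ _)
  · intro f hf
    simp only [mem_filter, mem_univ, true_and] at hf
    refine ⟨(f, 0), ?_, rfl⟩
    simp only [mem_filter, mem_univ, true_and]
    funext x
    rw [contentAdd, if_pos (Subsingleton.elim _ _), hf]
  · intro p _
    rfl

theorem bgrLinear_mul (n s : ℕ) (hs : 0 < s) (x y : descentAlgebra R (n + s)) :
    bgrLinear R n s (x * y) = bgrLinear R n s x * bgrLinear R n s y := by
  apply Subtype.ext
  rw [MulMemClass.coe_mul, coe_bgrLinear, coe_bgrLinear, coe_bgrLinear]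
  exact constr_mul R _ (fun a => Y R n s a) (fun a => Y R n s a) (n + s) le_rfl
    (fun _ => rfl) (fun r q => Y_mul R n s r q _ le_rfl)
    (fun A _ e h1 h2 => Y_restrict R n s hs e A h2 _ h1) x y

/-- The Bergeron-Garsia-Reutenauer map, as a homomorphism of algebras. -/
noncomputable def bgr (n s : ℕ) (hs : 0 < s) : descentAlgebra R (n + s) →ₐ[R] descentAlgebra R n :=
  AlgHom.ofLinearMap (bgrLinear R n s) (bgrLinear_one R n s hs) (bgrLinear_mul R n s hs)

/-- The pullback of modules along the Bergeron-Garsia-Reutenauer map: on `V` an element `a` of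
the descent algebra of degree `n + s` acts as `Δ_s(a)`. -/
noncomputable def pullback (n s : ℕ) (hs : 0 < s) :
    ModuleCat (descentAlgebra R n) ⥤ ModuleCat (descentAlgebra R (n + s)) :=
  ModuleCat.restrictScalars (bgr R n s hs).toRingHom

end BGR

/-! ### Young characters and the simple modules -/

/-- `σ` belongs to the conjugacy class labelled by `μ`. -/
def HasType {n : ℕ} (σ : Equiv.Perm (Fin n)) (μ : n.Partition) : Prop :=
  σ.partition.parts = μ.parts

theorem exists_hasType {n : ℕ} (μ : n.Partition) : ∃ σ : Equiv.Perm (Fin n), HasType σ μ := by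
  have hsum : (μ.parts.filter fun i => 2 ≤ i).sum + (μ.parts.filter fun i => ¬ 2 ≤ i).sum = n := by
    rw [← Multiset.sum_add, Multiset.filter_add_not, μ.parts_sum]
  have hrep : (μ.parts.filter fun i => ¬ 2 ≤ i) =
      Multiset.replicate (Multiset.card (μ.parts.filter fun i => ¬ 2 ≤ i)) 1 := by
    refine Multiset.eq_replicate_card.2 fun b hb => ?_
    rw [Multiset.mem_filter] at hb
    have := μ.parts_pos hb.1
    omega
  have hsum1 : (μ.parts.filter fun i => ¬ 2 ≤ i).sum =
      Multiset.card (μ.parts.filter fun i => ¬ 2 ≤ i) := by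
    conv_lhs => rw [hrep]
    simp
  obtain ⟨σ, hσ⟩ := (Equiv.Perm.exists_with_cycleType_iff (Fin n)
    (m := μ.parts.filter fun i => 2 ≤ i)).2
    ⟨by rw [Fintype.card_fin]; omega, fun a ha => (Multiset.mem_filter.1 ha).2⟩
  refine ⟨σ, ?_⟩
  unfold HasType
  rw [Equiv.Perm.parts_partition, hσ, ← Equiv.Perm.sum_cycleType, hσ, Fintype.card_fin]
  have : n - (μ.parts.filter fun i => 2 ≤ i).sum =
    Multiset.card (μ.parts.filter fun i => ¬ 2 ≤ i) := by omega
  rw [this, ← hrep, Multiset.filter_add_not]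

/-- A permutation in the conjugacy class labelled by `μ`. -/
noncomputable def permOf {n : ℕ} (μ : n.Partition) : Equiv.Perm (Fin n) :=
  (exists_hasType μ).choose

theorem hasType_permOf {n : ℕ} (μ : n.Partition) : HasType (permOf μ) μ :=
  (exists_hasType μ).choose_spec

/-- The number of cosets of the Young subgroup of `q` that are fixed by `σ`. -/
noncomputable def fixedCosets {n : ℕ} (q : Composition n) (σ : Equiv.Perm (Fin n)) : ℕ :=
  Nat.card {c : Equiv.Perm (Fin n) ⧸ youngSubgroup q // σ • c = c}

/-- The value `φ^q(μ)` of the Young character of `q` on the conjugacy class labelled by `μ`. -/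
noncomputable def youngChar {n : ℕ} (q : Composition n) (μ : n.Partition) : ℕ :=
  fixedCosets q (permOf μ)

/-- The Young character does not depend on the choice of a permutation of type `μ`. -/
theorem youngChar_eq {n : ℕ} (q : Composition n) (μ : n.Partition) (σ : Equiv.Perm (Fin n))
    (hσ : HasType σ μ) : youngChar q μ = fixedCosets q σ := by
  have h : IsConj (permOf μ) σ := by
    rw [Equiv.Perm.partition_eq_of_isConj, Nat.Partition.ext_iff, hasType_permOf μ, hσ]
  obtain ⟨c, hc⟩ := isConj_iff.1 h
  refine Nat.card_congr ((MulAction.toPerm c).subtypeEquiv fun x => ?_)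
  rw [MulAction.toPerm_apply, ← hc, smul_smul, inv_mul_cancel_right, mul_smul]
  exact (smul_left_cancel_iff c).symm

section Characters

variable (R : Type*) [CommRing R]

theorem fixedCosets_eq {n : ℕ} (q : Composition n) (σ : Equiv.Perm (Fin n)) :
    (fixedCosets q σ : R) = Z R σ q.blocksFun := by
  classical
  let f : Equiv.Perm (Fin n) ⧸ youngSubgroup q → Fin n → Fin q.length :=
    Quotient.lift (fun w : Equiv.Perm (Fin n) => q.index ∘ w.symm) (by
      intro a b hab
      have hab' : a⁻¹ * b ∈ youngSubgroup q := QuotientGroup.leftRel_apply.1 hab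
      funext x
      have := hab' (b.symm x)
      simp only [Equiv.Perm.mul_apply, Equiv.apply_symm_apply] at this
      exact this)
  have hf : ∀ w : Equiv.Perm (Fin n), f (QuotientGroup.mk w) = q.index ∘ w.symm := fun w => rfl
  have hinj : Function.Injective f := by
    intro a b
    refine QuotientGroup.induction_on a fun a => QuotientGroup.induction_on b fun b => ?_
    intro h
    rw [hf, hf] at h
    refine QuotientGroup.eq.2 fun x => ?_
    have := congrFun h (b x)
    simpa using this
  have hcont : ∀ c, content (f c) = q.blocksFun := by
    intro c
    refine QuotientGroup.induction_on c fun w => ?_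
    rw [hf, content_comp_perm, content_index]
  have hsm : ∀ c, f (σ • c) = f c ∘ σ.symm := by
    intro c
    refine QuotientGroup.induction_on c fun w => rfl
  unfold Z fixedCosets
  rw [sum_const, nsmul_one, Nat.card_eq_fintype_card]
  congr 1
  rw [← card_univ]
  refine card_bij (fun c _ => ⟨f c.1, ?_⟩) ?_ ?_ ?_
  · have h1 := hsm c.1
    rw [c.2] at h1
    conv_lhs => rw [h1]
    funext x
    simp
  · intro c _
    simp only [mem_filter, mem_univ, true_and]
    exact hcont c.1
  · intro c _ d _ h
    exact Subtype.ext (hinj (congrArg Subtype.val h))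
  · rintro ⟨g, hg⟩ hgc
    simp only [mem_filter, mem_univ, true_and] at hgc
    obtain ⟨w, hw⟩ := exists_perm_of_content (f := g) (g := q.index) (by rw [content_index, hgc])
    have hfw : f (QuotientGroup.mk w⁻¹) = g := by
      rw [hf]
      exact hw
    refine ⟨⟨QuotientGroup.mk w⁻¹, hinj ?_⟩, mem_univ _, Subtype.ext hfw⟩
    rw [hsm, hfw]
    funext x
    have := congrFun hg (σ.symm x)
    simpa using this.symm

/-- The linear map with `Ξ^q ↦ φ^q(μ)`. -/
noncomputable def charLinear {n : ℕ} (μ : n.Partition) : descentAlgebra R n →ₗ[R] R :=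
  (xiBasis R n).constr R fun q => (youngChar q μ : R)

theorem charLinear_one {n : ℕ} (μ : n.Partition) : charLinear R μ 1 = 1 := by
  classical
  refine constr_one R _ _ fun q e h1 h2 => ?_
  rw [youngChar, fixedCosets_eq, ← Z_restrict R _ e (fun _ : Fin 1 => n) h2 _ h1]
  unfold Z
  rw [sum_eq_single_of_mem ⟨fun _ => 0, rfl⟩]
  · simp only [mem_filter, mem_univ, true_and]
    funext l
    have : l = 0 := Subsingleton.elim _ _
    subst this
    simp [content]
  · intro b _ hb
    exact absurd (Subtype.ext (Subsingleton.elim _ _)) hb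

theorem charLinear_mul {n : ℕ} (μ : n.Partition) (x y : descentAlgebra R n) :
    charLinear R μ (x * y) = charLinear R μ x * charLinear R μ y :=
  constr_mul R _ (fun a => Z R (permOf μ) a) (fun a => Z R (permOf μ) a) n le_rfl
    (fun q => fixedCosets_eq R q _) (fun r q => Z_mul R _ r q _ le_rfl)
    (fun A _ e h1 h2 => Z_restrict R _ e A h2 _ h1) x y

/-- The character `a ↦ θ(a)(μ)` of the descent algebra, with `Ξ^q ↦ φ^q(μ)`. -/
noncomputable def char {n : ℕ} (μ : n.Partition) : descentAlgebra R n →ₐ[R] R :=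
  AlgHom.ofLinearMap (charLinear R μ) (charLinear_one R μ) (charLinear_mul R μ)

theorem char_xi {n : ℕ} (μ : n.Partition) (q : Composition n) :
    char R μ (xi R q) = (youngChar q μ : R) := by
  rw [← xiBasis_apply]
  exact Module.Basis.constr_basis (xiBasis R n) R _ q

end Characters

/-- The module `M_μ` over the descent algebra: free of rank one over `R`, and `Ξ^q` acts as
multiplication by `φ^q(μ)`. -/
def M (R : Type*) [CommRing R] {n : ℕ} (_ : n.Partition) : Type _ := R

noncomputable instance (R : Type*) [CommRing R] {n : ℕ} (μ : n.Partition) :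
    AddCommGroup (M R μ) := inferInstanceAs (AddCommGroup R)

noncomputable instance (R : Type*) [CommRing R] {n : ℕ} (μ : n.Partition) :
    Module (descentAlgebra R n) (M R μ) := Module.compHom R (char R μ).toRingHom

/-! ### `p`-regular partitions and `p`-equivalence

Here `p` is the characteristic of a field, so a prime number or `0`; the characteristic `0`
stands for `p = ∞`. -/

/-- A partition is `p`-regular if no part occurs `p` times or more. -/
def IsRegular (p : ℕ) {n : ℕ} (μ : n.Partition) : Prop :=
  p = 0 ∨ ∀ i, μ.parts.count i ≤ p - 1

/-- The `p`-regular partitions of `n`. -/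
def RegularPartition (p n : ℕ) : Type := {μ : n.Partition // IsRegular p μ}

/-- `τ` is the `p'`-part of `σ`: `σ = τ u` with commuting `τ` and `u`, where `τ` has order prime
to `p` and `u` has order a power of `p`.  For `p = ∞` the `p'`-part of `σ` is `σ`. -/
def IsPPrimePart (p : ℕ) {G : Type*} [Group G] (σ τ : G) : Prop :=
  if p = 0 then τ = σ
  else ∃ u, σ = τ * u ∧ Commute τ u ∧ (orderOf τ).Coprime p ∧ ∃ k, orderOf u = p ^ k

/-- `p`-equivalence of partitions: the `p'`-parts of permutations in the conjugacy classes
labelled by `μ` and `ν` are conjugate. -/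
def PEquiv (p : ℕ) {n : ℕ} (μ ν : n.Partition) : Prop :=
  ∀ σ τ σ' τ' : Equiv.Perm (Fin n), HasType σ μ → HasType τ ν →
    IsPPrimePart p σ σ' → IsPPrimePart p τ τ' → IsConj σ' τ'

/-- The partition obtained from `μ` by appending a part `s`. -/
def appendPart {n : ℕ} (μ : n.Partition) (s : ℕ) (hs : 0 < s) : (n + s).Partition where
  parts := s ::ₘ μ.parts
  parts_pos := fun {i} hi => by
    rcases Multiset.mem_cons.1 hi with rfl | hi
    · exact hs
    · exact μ.parts_pos hi
  parts_sum := by rw [Multiset.sum_cons, μ.parts_sum, add_comm]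

end Descent

/-!
The `p'`-part of a cycle of length `pᵃ m`, with `m` prime to `p`, consists of `pᵃ` cycles of
length `m`.  Two partitions are therefore `p`-equivalent if and only if they agree after every part
`pᵃ m` has been replaced by `pᵃ` parts `m`.  Merging `p` equal parts repeatedly shows that every
partition is `p`-equivalent to a `p`-regular one, and Glaisher's theorem then forces the regular
representative to be unique.

The cosets of `S_q` fixed by `σ` are the `σ`-invariant words of content `q`.  If `σ` has type `μ`
and is extended by a cycle of length `s`, an invariant word is a `σ`-invariant word followed by one
letter repeated `s` times; counting by that letter gives the formula for `Δ_s`.  Hence pulling back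
along `Δ_s` turns the character of `μ` into that of `μ` with a part `s` appended.

Since `σ` acts as a `p`-element on the points that its `p'`-part fixes, `σ` and its `p'`-part have
equally many fixed points modulo `p`.  So over `F` characters depend only on the `p`-equivalence
class, and the appended partition may be replaced by its `p`-regular representative.
-/

namespace Descent

open Finset

/-! ### Cycle types of `p'`-parts -/

/-- The cycle type of the `p'`-part of a permutation of cycle type `ν`: the `p'`-part of a cycle of
length `x` consists of `ordProj[p] x` cycles of length `ordCompl[p] x`. -/
def pPrimeParts (p : ℕ) (ν : Multiset ℕ) : Multiset ℕ :=
  ν.bind fun x => Multiset.replicate (ordProj[p] x) (ordCompl[p] x)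

theorem mem_pPrimeParts {p m : ℕ} {ν : Multiset ℕ} (hm : m ∈ pPrimeParts p ν) :
    ∃ x ∈ ν, m = ordCompl[p] x := by
  obtain ⟨x, hx, hmx⟩ := Multiset.mem_bind.1 hm
  exact ⟨x, hx, Multiset.eq_of_mem_replicate hmx⟩

theorem sum_pPrimeParts (p : ℕ) (ν : Multiset ℕ) : (pPrimeParts p ν).sum = ν.sum := by
  simp only [pPrimeParts, Multiset.sum_bind, Multiset.sum_replicate, smul_eq_mul,
    Nat.ordProj_mul_ordCompl_eq_self, Multiset.map_id']

theorem pPrimeParts_eq_self {p : ℕ} {ν : Multiset ℕ} (h : ∀ x ∈ ν, x.factorization p = 0) :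
    pPrimeParts p ν = ν := by
  refine (Multiset.bind_congr fun x hx => ?_).trans (Multiset.bind_singleton ν id) |>.trans
    ν.map_id
  simp only [h x hx, pow_zero, Nat.div_one, Multiset.replicate_one, id_eq]

theorem pPrimeParts_add (p : ℕ) (ν ν' : Multiset ℕ) :
    pPrimeParts p (ν + ν') = pPrimeParts p ν + pPrimeParts p ν' :=
  Multiset.add_bind _ _ _

theorem pPrimeParts_replicate (p k x : ℕ) : pPrimeParts p (Multiset.replicate k x) =
    Multiset.replicate (k * ordProj[p] x) (ordCompl[p] x) := by
  rw [pPrimeParts, Multiset.bind, Multiset.map_replicate, Multiset.join, Multiset.sum_replicate,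
    Multiset.nsmul_replicate]

theorem pPrimeParts_mul {p : ℕ} (hp : p.Prime) {x : ℕ} (hx : x ≠ 0) :
    pPrimeParts p {p * x} = pPrimeParts p (Multiset.replicate p x) := by
  have hproj : ordProj[p] (p * x) = p * ordProj[p] x := by
    rw [Nat.ordProj_mul p hp.ne_zero hx, hp.factorization_self, pow_one]
  have hcompl : ordCompl[p] (p * x) = ordCompl[p] x := by
    rw [hproj, Nat.mul_div_mul_left _ _ hp.pos]
  rw [← Multiset.replicate_one, pPrimeParts_replicate, pPrimeParts_replicate, hcompl, hproj,
    one_mul]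

theorem sum_filter_dvd_pPrimeParts (p : ℕ) (ν : Multiset ℕ) (d : ℕ) :
    ((pPrimeParts p ν).filter (· ∣ d)).sum = (ν.filter (ordCompl[p] · ∣ d)).sum := by
  induction ν using Multiset.induction_on with
  | empty => rfl
  | cons x ν ih =>
    rw [← Multiset.singleton_add, pPrimeParts_add, Multiset.filter_add, Multiset.filter_add,
      Multiset.sum_add, Multiset.sum_add, ih, ← Multiset.replicate_one, pPrimeParts_replicate]
    congr 1
    by_cases h : ordCompl[p] x ∣ d
    · rw [Multiset.filter_eq_self.2 fun b hb => Multiset.eq_of_mem_replicate hb ▸ h,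
        Multiset.filter_eq_self.2 fun b hb => Multiset.eq_of_mem_replicate hb ▸ h,
        Multiset.sum_replicate, Multiset.sum_replicate, smul_eq_mul, one_mul, one_smul,
        Nat.ordProj_mul_ordCompl_eq_self]
    · rw [Multiset.filter_eq_nil.2 fun b hb => Multiset.eq_of_mem_replicate hb ▸ h,
        Multiset.filter_eq_nil.2 fun b hb => Multiset.eq_of_mem_replicate hb ▸ h]

section Partition

variable {n : ℕ}

/-- The partition of `n` with parts `pPrimeParts p μ.parts`.  For `p = 0` it is `μ`. -/
def pPrimePartition (p : ℕ) (μ : n.Partition) : n.Partition where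
  parts := pPrimeParts p μ.parts
  parts_pos := fun hm => by
    obtain ⟨x, hx, rfl⟩ := mem_pPrimeParts hm
    exact Nat.ordCompl_pos p (μ.parts_pos hx).ne'
  parts_sum := (sum_pPrimeParts p μ.parts).trans μ.parts_sum

theorem pPrimePartition_zero (μ : n.Partition) : pPrimePartition 0 μ = μ :=
  Nat.Partition.ext (pPrimeParts_eq_self fun _ _ =>
    Nat.factorization_eq_zero_of_not_prime _ Nat.not_prime_zero)

theorem pPrimePartition_eq_self {p : ℕ} {μ : n.Partition} (h : ∀ x ∈ μ.parts, ¬ p ∣ x) :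
    pPrimePartition p μ = μ :=
  Nat.Partition.ext (pPrimeParts_eq_self fun x hx =>
    Nat.factorization_eq_zero_of_not_dvd (h x hx))

theorem pPrimePartition_mem_restricted {p : ℕ} (hp : p.Prime) (μ : n.Partition) :
    pPrimePartition p μ ∈ Nat.Partition.restricted n (¬ p ∣ ·) := by
  refine mem_filter.2 ⟨mem_univ _, fun m hm => ?_⟩
  obtain ⟨x, hx, rfl⟩ := mem_pPrimeParts hm
  exact Nat.not_dvd_ordCompl hp (μ.parts_pos hx).ne'

theorem pPrimePartition_appendPart_inj {p s : ℕ} {hs : 0 < s} {μ ν : n.Partition} :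
    pPrimePartition p (appendPart μ s hs) = pPrimePartition p (appendPart ν s hs) ↔
      pPrimePartition p μ = pPrimePartition p ν := by
  simp only [Nat.Partition.ext_iff, pPrimePartition, appendPart, ← Multiset.singleton_add,
    pPrimeParts_add, add_right_inj]

theorem isRegular_iff_mem_countRestricted {p : ℕ} (hp : p.Prime) {μ : n.Partition} :
    IsRegular p μ ↔ μ ∈ Nat.Partition.countRestricted n p := by
  have hpos := hp.pos
  simp only [IsRegular, hp.ne_zero, false_or, Nat.Partition.countRestricted, mem_filter, mem_univ,
    true_and, ← Nat.le_sub_one_iff_lt hpos]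
  refine ⟨fun h i _ => h i, fun h i => ?_⟩
  by_cases hi : i ∈ μ.parts
  · exact h i hi
  · rw [Multiset.count_eq_zero_of_notMem hi]
    exact Nat.zero_le _

theorem exists_merge_of_not_isRegular {p : ℕ} (hp : p.Prime) {μ : n.Partition}
    (hμ : ¬ IsRegular p μ) : ∃ ν : n.Partition,
      pPrimePartition p ν = pPrimePartition p μ ∧ ν.parts.card < μ.parts.card := by
  obtain ⟨x, hx⟩ : ∃ x, p - 1 < μ.parts.count x := by
    simpa only [IsRegular, hp.ne_zero, false_or, not_forall, not_le] using hμ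
  have hpx : p ≤ μ.parts.count x := Nat.le_of_pred_lt hx
  obtain ⟨t, ht⟩ := Multiset.le_iff_exists_add.1 (Multiset.le_count_iff_replicate_le.1 hpx)
  have hx0 : 0 < x := μ.parts_pos (Multiset.count_pos.1 (Nat.zero_lt_of_lt hx))
  refine ⟨⟨{p * x} + t, fun {i} hi => ?_, ?_⟩, Nat.Partition.ext ?_, ?_⟩
  · rcases Multiset.mem_add.1 hi with hi | hi
    · rw [Multiset.mem_singleton.1 hi]
      exact Nat.mul_pos hp.pos hx0
    · exact μ.parts_pos (ht ▸ Multiset.mem_add.2 (Or.inr hi))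
  · rw [← μ.parts_sum, ht, Multiset.sum_add, Multiset.sum_add, Multiset.sum_singleton,
      Multiset.sum_replicate, smul_eq_mul]
  · simp only [pPrimePartition, ht, pPrimeParts_add, pPrimeParts_mul hp hx0.ne']
  · simp only [ht, Multiset.card_add, Multiset.card_singleton, Multiset.card_replicate,
      Nat.add_lt_add_iff_right, hp.one_lt]

theorem exists_regularPartition {p : ℕ} (hp : p = 0 ∨ p.Prime) (μ : n.Partition) :
    ∃ ρ : RegularPartition p n, pPrimePartition p ρ.1 = pPrimePartition p μ := by
  rcases hp with rfl | hp
  · exact ⟨⟨μ, Or.inl rfl⟩, rfl⟩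
  induction hk : μ.parts.card using Nat.strong_induction_on generalizing μ with
  | _ k ih =>
    by_cases hμ : IsRegular p μ
    · exact ⟨⟨μ, hμ⟩, rfl⟩
    · obtain ⟨ν, hνμ, hcard⟩ := exists_merge_of_not_isRegular hp hμ
      obtain ⟨ρ, hρ⟩ := ih _ (hk ▸ hcard) ν rfl
      exact ⟨ρ, hρ.trans hνμ⟩

/-- By Glaisher's theorem it suffices that the map from `p`-regular partitions to partitions
without parts divisible by `p` is surjective. -/
theorem RegularPartition.pPrimePartition_injective {p : ℕ} (hp : p = 0 ∨ p.Prime) :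
    Function.Injective fun ρ : RegularPartition p n => pPrimePartition p ρ.1 := by
  rcases hp with rfl | hp
  · intro ρ ρ' h
    exact Subtype.ext (by simpa only [pPrimePartition_zero] using h)
  have hsurj : Set.SurjOn (pPrimePartition (n := n) p) ↑(Nat.Partition.countRestricted n p)
      ↑(Nat.Partition.restricted n (¬ p ∣ ·)) := by
    intro μ hμ
    obtain ⟨ρ, hρ⟩ := exists_regularPartition (Or.inr hp) μ
    exact ⟨ρ.1, (isRegular_iff_mem_countRestricted hp).1 ρ.2,
      hρ.trans (pPrimePartition_eq_self (mem_filter.1 hμ).2)⟩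
  have hinj : Set.InjOn (pPrimePartition (n := n) p) ↑(Nat.Partition.countRestricted n p) :=
    injOn_of_surjOn_of_card_le _ (fun μ _ => pPrimePartition_mem_restricted hp μ) hsurj
      (Nat.Partition.card_restricted_eq_card_countRestricted n hp.pos).ge
  exact fun ρ ρ' h => Subtype.ext (hinj ((isRegular_iff_mem_countRestricted hp).1 ρ.2)
    ((isRegular_iff_mem_countRestricted hp).1 ρ'.2) h)

end Partition

/-! ### Fixed points of powers and cycle types -/

theorem sum_filter_dvd (ν : Multiset ℕ) {d : ℕ} (hd : 0 < d) :
    (ν.filter (· ∣ d)).sum = ∑ m ∈ d.divisors, ν.count m * m := by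
  rw [sum_multiset_count_of_subset _ d.divisors fun m hm => Nat.mem_divisors.2
    ⟨(Multiset.mem_filter.1 (Multiset.mem_toFinset.1 hm)).2, hd.ne'⟩]
  refine sum_congr rfl fun m hm => ?_
  rw [Multiset.count_filter_of_pos (p := (· ∣ d)) (Nat.dvd_of_mem_divisors hm), smul_eq_mul]

theorem eq_of_sum_filter_dvd_eq {ν ρ : Multiset ℕ} (hν : 0 ∉ ν) (hρ : 0 ∉ ρ)
    (h : ∀ d > 0, (ν.filter (· ∣ d)).sum = (ρ.filter (· ∣ d)).sum) : ν = ρ := by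
  have hinv := fun ξ : Multiset ℕ => (ArithmeticFunction.sum_eq_iff_sum_mul_moebius_eq
    (f := fun m => ((ξ.count m * m : ℕ) : ℤ)) (g := fun d => ((ξ.filter (· ∣ d)).sum : ℤ))).1
    fun d hd => by rw [sum_filter_dvd ξ hd, Nat.cast_sum]
  ext x
  rcases Nat.eq_zero_or_pos x with rfl | hx
  · rw [Multiset.count_eq_zero_of_notMem hν, Multiset.count_eq_zero_of_notMem hρ]
  · have hcount : ((ν.count x * x : ℕ) : ℤ) = (ρ.count x * x : ℕ) := by
      rw [← hinv ν x hx, ← hinv ρ x hx]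
      refine sum_congr rfl fun y hy => ?_
      have hyx : y.2 ∣ x := (Nat.mem_divisorsAntidiagonal.1 hy).1 ▸ Dvd.intro_left _ rfl
      rw [h y.2 (Nat.pos_of_dvd_of_pos hyx hx)]
    exact Nat.eq_of_mul_eq_mul_right hx (Nat.cast_injective hcount)

theorem dvd_mul_pow_iff_ordCompl_dvd {p x d N : ℕ} (hp : p.Prime) (hx : x ≠ 0)
    (hN : x.factorization p ≤ N) : x ∣ d * p ^ N ↔ ordCompl[p] x ∣ d := by
  refine ⟨fun h => ?_, fun h => ?_⟩
  · exact ((Nat.coprime_ordCompl hp hx).symm.pow_right N).dvd_of_dvd_mul_right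
      ((Nat.ordCompl_dvd x p).trans h)
  · rw [← Nat.ordProj_mul_ordCompl_eq_self x p, mul_comm]
    exact mul_dvd_mul h (pow_dvd_pow p hN)

section FixedPoints

variable {α : Type*} [Fintype α] [DecidableEq α]

theorem card_support_fixed_pow (σ : Equiv.Perm α) (d : ℕ) :
    #{x ∈ σ.support | (σ ^ d) x = x} = (σ.cycleType.filter (· ∣ d)).sum := by
  induction σ using Equiv.Perm.cycle_induction_on with
  | base_one => simp
  | base_cycles σ hσ =>
    rw [hσ.cycleType, Multiset.filter_singleton]
    have hfix : ∀ x ∈ σ.support, (σ ^ d) x = x ↔ #σ.support ∣ d := fun x hx => by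
      rw [← hσ.orderOf, orderOf_dvd_iff_pow_eq_one,
        hσ.pow_eq_one_iff' (Equiv.Perm.mem_support.1 hx)]
    rw [filter_congr hfix, filter_const]
    split_ifs <;> simp
  | induction_disjoint σ τ hd _ hσ hτ =>
    have hleft : ∀ x ∈ σ.support, ((σ * τ) ^ d) x = x ↔ (σ ^ d) x = x := fun x hx => by
      rw [hd.commute.mul_pow, Equiv.Perm.mul_apply, Equiv.Perm.pow_apply_eq_self_of_apply_eq_self
        ((hd x).resolve_left (Equiv.Perm.mem_support.1 hx))]
    have hright : ∀ x ∈ τ.support, ((σ * τ) ^ d) x = x ↔ (τ ^ d) x = x := fun x hx => by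
      rw [hd.commute.eq, hd.commute.symm.mul_pow, Equiv.Perm.mul_apply,
        Equiv.Perm.pow_apply_eq_self_of_apply_eq_self
          ((hd x).resolve_right (Equiv.Perm.mem_support.1 hx))]
    rw [hd.cycleType_mul, Multiset.filter_add, Multiset.sum_add, ← hσ, ← hτ, hd.support_mul,
      filter_union, card_union_of_disjoint (disjoint_filter_filter hd.disjoint_support),
      filter_congr hleft, filter_congr hright]

theorem card_fixed_pow (σ : Equiv.Perm α) (d : ℕ) :
    #{x | (σ ^ d) x = x} = (σ.partition.parts.filter (· ∣ d)).sum := by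
  have hcompl : ∀ x ∈ σ.supportᶜ, (σ ^ d) x = x := fun x hx =>
    Equiv.Perm.pow_apply_eq_self_of_apply_eq_self (by simpa using hx) d
  rw [Equiv.Perm.parts_partition, Multiset.filter_add, Multiset.sum_add, ← card_support_fixed_pow,
    Multiset.filter_eq_self.2 fun b hb => (Multiset.eq_of_mem_replicate hb) ▸ one_dvd d,
    Multiset.sum_replicate, smul_eq_mul, mul_one, ← card_compl, ← filter_true_of_mem hcompl,
    ← card_union_of_disjoint (disjoint_filter_filter disjoint_compl_right), ← filter_union,
    union_compl]

end FixedPoints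

theorem hasType_iff_card_fixed_pow {n : ℕ} {σ : Equiv.Perm (Fin n)} {μ : n.Partition} :
    HasType σ μ ↔ ∀ d > 0, #{x | (σ ^ d) x = x} = (μ.parts.filter (· ∣ d)).sum := by
  simp only [card_fixed_pow]
  refine ⟨fun h d _ => h ▸ rfl, fun h => ?_⟩
  exact eq_of_sum_filter_dvd_eq (fun h0 => (σ.partition.parts_pos h0).ne rfl)
    (fun h0 => (μ.parts_pos h0).ne rfl) h

theorem isConj_iff_of_hasType {n : ℕ} {σ τ : Equiv.Perm (Fin n)} {μ ν : n.Partition}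
    (hσ : HasType σ μ) (hτ : HasType τ ν) : IsConj σ τ ↔ μ = ν := by
  rw [Equiv.Perm.partition_eq_of_isConj, Nat.Partition.ext_iff, Nat.Partition.ext_iff, hσ, hτ]

section PPrimePart

variable {G : Type*} [Group G] {p : ℕ}

theorem mem_of_pow_mem_of_coprime {H : Subgroup G} {g : G} {k : ℕ} (h : g ^ k ∈ H)
    (hk : k.Coprime (orderOf g)) : g ∈ H := by
  obtain ⟨m, hm⟩ := exists_pow_eq_self_of_coprime hk
  exact hm ▸ pow_mem h m

theorem isPPrimePart_zero_iff {σ τ : G} : IsPPrimePart 0 σ τ ↔ τ = σ := by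
  rw [IsPPrimePart, if_pos rfl]

theorem isPPrimePart_iff (hp : p.Prime) {σ τ : G} : IsPPrimePart p σ τ ↔
    ∃ u, σ = τ * u ∧ Commute τ u ∧ (orderOf τ).Coprime p ∧ ∃ k, orderOf u = p ^ k := by
  rw [IsPPrimePart, if_neg hp.ne_zero]

theorem IsPPrimePart.pow_mem_iff (hp : p.Prime) {σ τ : G} (h : IsPPrimePart p σ τ) :
    ∃ k, ∀ N ≥ k, ∀ (H : Subgroup G) (d : ℕ), σ ^ (d * p ^ N) ∈ H ↔ τ ^ d ∈ H := by
  obtain ⟨u, rfl, hcomm, hτ, k, hu⟩ := (isPPrimePart_iff hp).1 h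
  refine ⟨k, fun N hN H d => ?_⟩
  have hu1 : u ^ (d * p ^ N) = 1 := orderOf_dvd_iff_pow_eq_one.1
    (hu ▸ (pow_dvd_pow p hN).mul_left d)
  rw [hcomm.mul_pow, hu1, mul_one, pow_mul]
  refine ⟨fun h => mem_of_pow_mem_of_coprime h ?_, fun h => pow_mem h _⟩
  exact ((hτ.coprime_dvd_left (orderOf_pow_dvd d)).pow_right N).symm

theorem exists_commute_mul_of_pow_mul_eq_one {σ : G} {m n : ℕ} (hmn : m.Coprime n)
    (hσ : σ ^ (m * n) = 1) : ∃ τ u, σ = τ * u ∧ Commute τ u ∧ τ ^ n = 1 ∧ u ^ m = 1 := by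
  have hbezout : (m : ℤ) * m.gcdA n + n * m.gcdB n = 1 := by
    rw [← Nat.gcd_eq_gcd_ab, hmn.gcd_eq_one, Nat.cast_one]
  have hσ' : σ ^ ((m : ℤ) * n) = 1 := by exact_mod_cast hσ
  refine ⟨σ ^ ((m : ℤ) * m.gcdA n), σ ^ ((n : ℤ) * m.gcdB n), ?_,
    (Commute.refl σ).zpow_zpow _ _, ?_, ?_⟩
  · rw [← zpow_add, hbezout, zpow_one]
  · rw [← zpow_natCast, ← zpow_mul, mul_right_comm, zpow_mul, hσ', one_zpow]
  · rw [← zpow_natCast, ← zpow_mul, mul_right_comm, mul_comm (n : ℤ), zpow_mul, hσ', one_zpow]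

theorem exists_isPPrimePart [Finite G] (hp : p = 0 ∨ p.Prime) (σ : G) :
    ∃ τ, IsPPrimePart p σ τ := by
  rcases hp with rfl | hp
  · exact ⟨σ, isPPrimePart_zero_iff.2 rfl⟩
  have hcop := Nat.coprime_ordCompl hp (orderOf_pos σ).ne'
  obtain ⟨τ, u, hσ, hcomm, hτ, hu⟩ := exists_commute_mul_of_pow_mul_eq_one
    (hcop.pow_left ((orderOf σ).factorization p))
    (by rw [Nat.ordProj_mul_ordCompl_eq_self, pow_orderOf_eq_one])
  obtain ⟨k, -, hk⟩ := (Nat.dvd_prime_pow hp).1 (orderOf_dvd_of_pow_eq_one hu)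
  exact ⟨τ, (isPPrimePart_iff hp).2
    ⟨u, hσ, hcomm, hcop.symm.coprime_dvd_left (orderOf_dvd_of_pow_eq_one hτ), k, hk⟩⟩

end PPrimePart

theorem IsPPrimePart.hasType {n p : ℕ} (hp : p = 0 ∨ p.Prime) {σ τ : Equiv.Perm (Fin n)}
    {μ : n.Partition} (h : IsPPrimePart p σ τ) (hσ : HasType σ μ) :
    HasType τ (pPrimePartition p μ) := by
  rcases hp with rfl | hp
  · rwa [isPPrimePart_zero_iff.1 h, pPrimePartition_zero]
  refine hasType_iff_card_fixed_pow.2 fun d _ => ?_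
  obtain ⟨k, hk⟩ := h.pow_mem_iff hp
  set N := k + n
  have hfix : ∀ x, (τ ^ d) x = x ↔ (σ ^ (d * p ^ N)) x = x := fun x =>
    (hk N (Nat.le_add_right k n) (MulAction.stabilizer _ x) d).symm
  have hdvd : ∀ x ∈ μ.parts, x ∣ d * p ^ N ↔ ordCompl[p] x ∣ d := fun x hx =>
    dvd_mul_pow_iff_ordCompl_dvd hp (μ.parts_pos hx).ne' <|
      ((Nat.factorization_lt p (μ.parts_pos hx).ne').le.trans (μ.le_of_mem_parts hx)).trans
        (Nat.le_add_left n k)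
  simp only [hfix]
  rw [card_fixed_pow, hσ, Multiset.filter_congr hdvd]
  exact (sum_filter_dvd_pPrimeParts p μ.parts d).symm

theorem pEquiv_iff {n p : ℕ} (hp : p = 0 ∨ p.Prime) {μ ν : n.Partition} :
    PEquiv p μ ν ↔ pPrimePartition p μ = pPrimePartition p ν := by
  refine ⟨fun h => ?_, fun h σ τ σ' τ' hσ hτ hσ' hτ' =>
    (isConj_iff_of_hasType (hσ'.hasType hp hσ) (hτ'.hasType hp hτ)).2 h⟩
  have hμ := hasType_permOf μ
  have hν := hasType_permOf ν
  obtain ⟨σ', hσ'⟩ := exists_isPPrimePart hp (permOf μ)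
  obtain ⟨τ', hτ'⟩ := exists_isPPrimePart hp (permOf ν)
  exact (isConj_iff_of_hasType (hσ'.hasType hp hμ) (hτ'.hasType hp hν)).1
    (h _ _ _ _ hμ hν hσ' hτ')

/-! ### Appending a cycle -/

section AppendPerm

variable {m n : ℕ}

/-- The permutation that acts as `σ` on the first `m` letters and as `τ` on the last `n`
letters. -/
def appendPerm (σ : Equiv.Perm (Fin m)) (τ : Equiv.Perm (Fin n)) : Equiv.Perm (Fin (m + n)) :=
  finSumFinEquiv.permCongr (Equiv.Perm.sumCongr σ τ)

variable (σ : Equiv.Perm (Fin m)) (τ : Equiv.Perm (Fin n))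

theorem appendPerm_castAdd (i : Fin m) :
    appendPerm σ τ (Fin.castAdd n i) = Fin.castAdd n (σ i) := by
  simp [appendPerm, Equiv.permCongr_apply]

theorem appendPerm_natAdd (i : Fin n) :
    appendPerm σ τ (Fin.natAdd m i) = Fin.natAdd m (τ i) := by
  simp [appendPerm, Equiv.permCongr_apply]

theorem appendPerm_pow (d : ℕ) : appendPerm σ τ ^ d = appendPerm (σ ^ d) (τ ^ d) := by
  have h := map_pow (Equiv.Perm.sumCongrHom (Fin m) (Fin n)) (σ, τ) d
  exact ((map_pow (finSumFinEquiv (m := m) (n := n)).permCongrHom _ d).symm.trans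
    (congrArg _ h.symm))

theorem card_fixed_appendPerm :
    #{x | appendPerm σ τ x = x} = #{x | σ x = x} + #{x | τ x = x} := by
  simp only [card_filter, Fin.sum_univ_add, appendPerm_castAdd, appendPerm_natAdd,
    (Fin.castAdd_injective m n).eq_iff, (Fin.natAdd_injective n m).eq_iff]

theorem parts_partition_finRotate {s : ℕ} (hs : 0 < s) :
    (finRotate s).partition.parts = {s} := by
  obtain rfl | ⟨k, rfl⟩ : s = 1 ∨ ∃ k, s = k + 2 := by
    rcases s with _ | _ | k
    exacts [absurd hs (lt_irrefl 0), Or.inl rfl, Or.inr ⟨k, rfl⟩]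
  · rw [Subsingleton.elim (finRotate 1) 1, Equiv.Perm.parts_partition]
    simp
  · rw [Equiv.Perm.parts_partition, cycleType_finRotate, support_finRotate]
    simp

theorem HasType.appendPerm_finRotate {s : ℕ} (hs : 0 < s) {σ : Equiv.Perm (Fin n)}
    {μ : n.Partition} (hσ : HasType σ μ) :
    HasType (appendPerm σ (finRotate s)) (appendPart μ s hs) := by
  refine hasType_iff_card_fixed_pow.2 fun d _ => ?_
  rw [appendPerm_pow, card_fixed_appendPerm, card_fixed_pow, card_fixed_pow, hσ,
    parts_partition_finRotate hs, add_comm, ← Multiset.sum_add, ← Multiset.filter_add]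
  rfl

end AppendPerm

section InvariantWords

variable {n s : ℕ} {L : Type*}

theorem append_comp_appendPerm {m : ℕ} (f : Fin m → L) (g : Fin n → L) (σ : Equiv.Perm (Fin m))
    (τ : Equiv.Perm (Fin n)) :
    Fin.append f g ∘ appendPerm σ τ = Fin.append (f ∘ σ) (g ∘ τ) := by
  funext x
  refine Fin.addCases (fun i => ?_) (fun i => ?_) x
  · rw [Function.comp_apply, appendPerm_castAdd, Fin.append_left, Fin.append_left,
      Function.comp_apply]
  · rw [Function.comp_apply, appendPerm_natAdd, Fin.append_right, Fin.append_right,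
      Function.comp_apply]

theorem comp_finRotate_eq_iff (hs : 0 < s) {g : Fin s → L} :
    g ∘ finRotate s = g ↔ g = fun _ => g ⟨0, hs⟩ := by
  obtain ⟨k, rfl⟩ := Nat.exists_eq_succ_of_ne_zero hs.ne'
  refine ⟨fun h => ?_, fun h => by rw [h]; rfl⟩
  funext i
  induction i using Fin.induction with
  | zero => rfl
  | succ i ih =>
    rw [← ih, ← Fin.coeSucc_eq_succ, ← finRotate_apply]
    exact congrFun h i.castSucc

/-- A word on `n + s` letters that is invariant under `σ` followed by a cycle of length `s` consists
of a `σ`-invariant word on the first `n` letters and a letter that is repeated `s` times. -/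
def invariantWordEquiv (hs : 0 < s) (σ : Equiv.Perm (Fin n)) :
    {f : Fin n → L // f ∘ σ = f} × L ≃
      {g : Fin (n + s) → L // g ∘ appendPerm σ (finRotate s) = g} where
  toFun p := ⟨Fin.append p.1.1 fun _ => p.2, by
    rw [append_comp_appendPerm, p.1.2]
    rfl⟩
  invFun g := (⟨fun i => g.1 (Fin.castAdd s i), funext fun i => by
    simpa only [Function.comp_apply, appendPerm_castAdd] using congrFun g.2 (Fin.castAdd s i)⟩,
    g.1 (Fin.natAdd n ⟨0, hs⟩))
  left_inv p := by
    simp only [Fin.append_left, Fin.append_right]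
  right_inv g := by
    have hconst := (comp_finRotate_eq_iff hs (g := fun i => g.1 (Fin.natAdd n i))).1 <|
      funext fun i => by
        simpa only [Function.comp_apply, appendPerm_natAdd] using congrFun g.2 (Fin.natAdd n i)
    refine Subtype.ext ?_
    conv_rhs => rw [← Fin.append_castAdd_natAdd (f := g.1), hconst]

theorem content_append_const [DecidableEq L] (f : Fin n → L) (i : L) :
    content (Fin.append f fun _ : Fin s => i) = contentAdd s (f, i) := by
  funext j
  simp only [content, contentAdd, card_filter, Fin.sum_univ_add, Fin.append_left,
    Fin.append_right, sum_const, card_univ, Fintype.card_fin, smul_eq_mul, mul_ite, mul_one,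
    mul_zero]

theorem contentAdd_eq_iff [DecidableEq L] {f : Fin n → L} {i : L} {a : L → ℕ} :
    contentAdd s (f, i) = a ↔
      s ≤ a i ∧ content f = fun j => if j = i then a j - s else a j := by
  constructor
  · rintro rfl
    refine ⟨by simp [contentAdd], funext fun j => ?_⟩
    by_cases hj : j = i
    · simp [contentAdd, hj]
    · simp [contentAdd, hj, Ne.symm hj]
  · rintro ⟨hi, hf⟩
    funext j
    rw [contentAdd, hf]
    by_cases hj : j = i
    · simp [hj, hi]
    · simp [hj, Ne.symm hj]

theorem Z_appendPerm_finRotate (R : Type*) [CommRing R] (hs : 0 < s) (σ : Equiv.Perm (Fin n))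
    [LinearOrder L] [Fintype L] (a : L → ℕ) :
    Z R (appendPerm σ (finRotate s)) a =
      ∑ i : {i // s ≤ a i}, Z R σ fun j : L => if j = i then a j - s else a j := by
  classical
  have hsplit : Z R (appendPerm σ (finRotate s)) a =
      ∑ i : L, ∑ f : {f : Fin n → L // f ∘ σ = f}, if contentAdd s (f.1, i) = a then 1 else 0 := by
    rw [Z, sum_filter, ← Fintype.sum_prod_type_right']
    refine (Fintype.sum_equiv (invariantWordEquiv hs σ) _ _ fun p => ?_).symm
    rw [← content_append_const]
    rfl
  rw [hsplit]
  refine sum_congr_set {i | s ≤ a i} _ _ (fun i hi => ?_) fun i hi => ?_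
  · simp only [Z, sum_filter, contentAdd_eq_iff, show s ≤ a i from hi, true_and]
  · exact sum_eq_zero fun f _ => if_neg fun h => hi (contentAdd_eq_iff.1 h).1

end InvariantWords

section YoungCharacters

variable {n s : ℕ}

theorem sum_blocksFun_sub (q : Composition (n + s)) {i : Fin q.length} (hi : s ≤ q.blocksFun i) :
    ∑ j, (if j = i then q.blocksFun j - s else q.blocksFun j) = n := by
  have hcongr : ∀ j, (if j = i then q.blocksFun j - s else q.blocksFun j) +
      (if j = i then s else 0) = q.blocksFun j := fun j => by
    split_ifs with hj
    · exact Nat.sub_add_cancel (hj ▸ hi)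
    · rfl
  have hsum := q.sum_blocksFun
  rw [← sum_congr rfl fun j _ => hcongr j, sum_add_distrib, sum_ite_eq', if_pos (mem_univ i)]
    at hsum
  exact Nat.add_right_cancel hsum

theorem Z_blocksFun_sub (R : Type*) [CommRing R] (q : Composition (n + s)) {i : Fin q.length}
    (hi : s ≤ q.blocksFun i) (σ : Equiv.Perm (Fin n)) :
    Z R σ (fun j => if j = i then q.blocksFun j - s else q.blocksFun j) =
      fixedCosets (subPart q i hi) σ := by
  obtain ⟨e, he⟩ := subPart_embedding q i hi
  rw [fixedCosets_eq]
  refine Z_restrict R σ e _ (zero_off_range e.toEmbedding _ _ he ?_) _ he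
  rw [(subPart q i hi).sum_blocksFun, sum_blocksFun_sub q hi]

theorem youngChar_appendPart (hs : 0 < s) (μ : n.Partition) (q : Composition (n + s)) :
    youngChar q (appendPart μ s hs) =
      ∑ i : {i // s ≤ q.blocksFun i}, youngChar (subPart q i.1 i.2) μ := by
  refine Nat.cast_injective (R := ℤ) ?_
  rw [youngChar_eq q _ _ ((hasType_permOf μ).appendPerm_finRotate hs), fixedCosets_eq,
    Z_appendPerm_finRotate ℤ hs, Nat.cast_sum]
  exact sum_congr rfl fun i _ => Z_blocksFun_sub ℤ q i.2 _

variable (R : Type*) [CommRing R]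

theorem algHom_ext {A : Type*} [Ring A] [Algebra R A] {f g : descentAlgebra R n →ₐ[R] A}
    (h : ∀ q, f (xi R q) = g (xi R q)) : f = g :=
  AlgHom.toLinearMap_injective <| (xiBasis R n).ext fun q => by
    rw [xiBasis_apply]
    exact h q

theorem char_comp_bgr (hs : 0 < s) (μ : n.Partition) :
    (char R μ).comp (bgr R n s hs) = char R (appendPart μ s hs) := by
  refine algHom_ext R fun q => ?_
  rw [AlgHom.comp_apply, char_xi, youngChar_appendPart, Nat.cast_sum]
  change char R μ (bgrLinear R n s (xi R q)) = _
  rw [bgrLinear_xi, map_sum]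
  exact sum_congr rfl fun i _ => char_xi R _ _

end YoungCharacters

/-! ### Characters modulo `p` -/

section ModP

theorem IsPPrimePart.card_fixedBy_modEq {p : ℕ} (hp : p.Prime) {G X : Type*} [Group G]
    [MulAction G X] [Finite X] {σ τ : G} (h : IsPPrimePart p σ τ) :
    Nat.card (MulAction.fixedBy X τ) ≡ Nat.card (MulAction.fixedBy X σ) [MOD p] := by
  have := Fact.mk hp
  obtain ⟨u, hσ, hcomm, -, k, hu⟩ := (isPPrimePart_iff hp).1 h
  have hτσ : ∀ x : X, σ • x = x → τ • x = x := fun x hx => by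
    obtain ⟨N, hN⟩ := h.pow_mem_iff hp
    simpa only [MulAction.mem_stabilizer_iff, pow_one] using
      (hN N le_rfl (MulAction.stabilizer G x) 1).1 (pow_mem hx _)
  let Y : SubMulAction (Subgroup.zpowers u) X :=
    { carrier := MulAction.fixedBy X τ
      smul_mem' := by
        rintro ⟨_, j, rfl⟩ x hx
        change τ • u ^ j • x = u ^ j • x
        rw [smul_smul, (hcomm.zpow_right j).eq, mul_smul, hx] }
  have hfixed : ∀ y : Y, y ∈ MulAction.fixedPoints (Subgroup.zpowers u) Y ↔
      y.1 ∈ MulAction.fixedBy X σ := fun y => by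
    have hy : τ • y.1 = y.1 := y.2
    rw [MulAction.mem_fixedBy, hσ, hcomm.eq, mul_smul, hy]
    refine ⟨fun hu => congrArg Subtype.val (hu ⟨u, Subgroup.mem_zpowers u⟩), ?_⟩
    rintro hu ⟨_, j, rfl⟩
    exact Subtype.ext (MulAction.mem_fixedBy_zpow hu j)
  have hcard := (IsPGroup.of_card ((Nat.card_zpowers u).trans hu)).card_modEq_card_fixedPoints Y
  rwa [Nat.card_congr ((Equiv.subtypeEquivRight hfixed).trans
    (Equiv.subtypeSubtypeEquivSubtype (hτσ _)))] at hcard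

variable (R : Type*) [CommRing R] {n p : ℕ} [CharP R p]

theorem youngChar_pPrimePartition (hp : p = 0 ∨ p.Prime) (q : Composition n) (μ : n.Partition) :
    (youngChar q (pPrimePartition p μ) : R) = youngChar q μ := by
  rcases hp with rfl | hp
  · rw [pPrimePartition_zero]
  obtain ⟨τ, hτ⟩ := exists_isPPrimePart (Or.inr hp) (permOf μ)
  rw [youngChar_eq q _ τ (hτ.hasType (Or.inr hp) (hasType_permOf μ))]
  exact (CharP.natCast_eq_natCast R p).2 (hτ.card_fixedBy_modEq hp)

theorem char_pPrimePartition (hp : p = 0 ∨ p.Prime) (μ : n.Partition) :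
    char R (pPrimePartition p μ) = char R μ :=
  algHom_ext R fun q => by rw [char_xi, char_xi, youngChar_pPrimePartition R hp]

end ModP

section Modules

theorem smul_M {R : Type*} [CommRing R] {n : ℕ} {μ : n.Partition} (a : descentAlgebra R n)
    (x : M R μ) : a • x = (char R μ a * (show R from x) : R) := rfl

theorem isSimpleModule_M (F : Type*) [Field F] {n : ℕ} (μ : n.Partition) :
    IsSimpleModule (descentAlgebra F n) (M F μ) := by
  rw [isSimpleModule_iff_toSpanSingleton_surjective]
  refine ⟨inferInstanceAs (Nontrivial F), fun x hx y => ?_⟩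
  refine ⟨algebraMap F _ ((show F from y) * (show F from x)⁻¹), ?_⟩
  rw [LinearMap.toSpanSingleton_apply, smul_M, AlgHom.commutes]
  exact inv_mul_cancel_right₀ (show (show F from x) ≠ 0 from hx) _

/-- The identity of `R`, as an isomorphism from the pullback of `M_μ` to `M_ν`. -/
noncomputable def pullbackIso {R : Type*} [CommRing R] {n s : ℕ} {hs : 0 < s} {μ : n.Partition}
    {ν : (n + s).Partition} (h : (char R μ).comp (bgr R n s hs) = char R ν) :
    (pullback R n s hs).obj (ModuleCat.of (descentAlgebra R n) (M R μ)) ≅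
      ModuleCat.of (descentAlgebra R (n + s)) (M R ν) :=
  let X := (pullback R n s hs).obj (ModuleCat.of (descentAlgebra R n) (M R μ))
  let e : X ≃ₗ[descentAlgebra R (n + s)] M R ν :=
    { toFun := fun x => (show R from x)
      invFun := fun x => (show R from x)
      map_add' := fun _ _ => rfl
      map_smul' := fun a x => congrArg (· * (show R from x)) (AlgHom.congr_fun h a)
      left_inv := fun _ => rfl
      right_inv := fun _ => rfl }
  e.toModuleIso

end Modules

end Descent

theorem theorem4p5 (F : Type*) [Field F] (p : ℕ) [CharP F p] (s : ℕ) (hs : 0 < s) :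
    ∃ sharp : ∀ n : ℕ, Descent.RegularPartition p n → Descent.RegularPartition p (n + s),
      (∀ (n : ℕ) (μ : Descent.RegularPartition p n) (ν : Descent.RegularPartition p (n + s)),
        Descent.PEquiv p ν.1 (Descent.appendPart μ.1 s hs) ↔ ν = sharp n μ) ∧
      (∀ (n : ℕ) (μ : Descent.RegularPartition p n),
        IsSimpleModule (Descent.descentAlgebra F n) (Descent.M F μ.1) ∧
        IsSimpleModule (Descent.descentAlgebra F (n + s)) (Descent.M F (sharp n μ).1) ∧
        Nonempty ((Descent.pullback F n s hs).obj
            (ModuleCat.of (Descent.descentAlgebra F n) (Descent.M F μ.1)) ≅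
          ModuleCat.of (Descent.descentAlgebra F (n + s)) (Descent.M F (sharp n μ).1))) ∧
      Function.Injective (fun x : Σ n : ℕ, Descent.RegularPartition p n =>
        (⟨x.1 + s, sharp x.1 x.2⟩ : Σ n : ℕ, Descent.RegularPartition p n)) := by
  have hp : p = 0 ∨ p.Prime := (CharP.char_is_prime_or_zero F p).symm
  choose sharp hsharp using fun (n : ℕ) (μ : Descent.RegularPartition p n) =>
    Descent.exists_regularPartition hp (Descent.appendPart μ.1 s hs)
  refine ⟨sharp, fun n μ ν => ?_, fun n μ => ⟨Descent.isSimpleModule_M F _,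
    Descent.isSimpleModule_M F _, ⟨Descent.pullbackIso ?_⟩⟩, ?_⟩
  · rw [Descent.pEquiv_iff hp, ← hsharp n μ]
    exact (Descent.RegularPartition.pPrimePartition_injective hp).eq_iff
  · rw [Descent.char_comp_bgr, ← Descent.char_pPrimePartition F hp, ← hsharp,
      Descent.char_pPrimePartition F hp]
  · rintro ⟨n, μ⟩ ⟨n', μ'⟩ h
    obtain ⟨hn, hμ⟩ := Sigma.mk.inj h
    obtain rfl : n = n' := Nat.add_right_cancel hn
    have happend := hsharp n μ
    rw [eq_of_heq hμ, hsharp, Descent.pPrimePartition_appendPart_inj] at happend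
    exact congrArg (Sigma.mk n)
      (Descent.RegularPartition.pPrimePartition_injective hp happend).symm
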